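/- Let $f_0,f_1$ be probability densities with respect to a $\sigma$-finite measure $\nu$ whose Kullback–Leibler divergences $I_0=\int \log(f_0/f_1)\,f_0\,d\nu$ and $I_1=\int\log(f_1/f_0)\,f_1\,d\nu$ are positive and finite. For $i\in\{0,1\}$ let $\mathsf P_i$ be the law of an i.i.d. sequence $X=(X_n)_{n\ge1}$ with density $f_i$, let $\mathsf E_i$ be the corresponding expectation, and for $\pi\in[0,1]$ let $\mathsf E_\pi$ be the expectation under $(1-\pi)\mathsf P_0+\pi\mathsf P_1$. A *test* is a pair $(T,D)$, where $T$ is a stopping time of the filtration $\mathcal F_n=\sigma(X_1,\dots,X_n)$, $n\ge 1$, with values in $\{1,2,\dots\}\cup\{\infty\}$, and $D$ is a $\{0,1\}$-valued random variable with $\{T=n,D=i\}\in\mathcal F_n$ for all $n\ge1$ and $i\in\{0,1\}$. For $\alpha,\beta\in(0,1)$ let $\mathcal E(\alpha,\beta)$ be the set of tests with $\mathsf P_0(D=1)\le\alpha$ and $\mathsf P_1(D=0)\le\beta$, and put $\mathcal L_\pi(\alpha,\beta)=\inf_{(T,D)\in\mathcal E(\alpha,\beta)}\mathsf E_\pi[T]$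 for $\pi\in[0,1]$. Let $l_m,u_m,\kappa_m,\iota_m$ ($m\in\mathbb N$) be nonnegative integers such that, for all sufficiently large $m$, $l_m\le u_m\le m$, $1\le\iota_m<u_m$ and $1\le\kappa_m<m-l_m$. Let $\mathsf B(n,p;k)$ be the probability that a Binomial$(n,p)$ variable is at least $k$. For $\alpha,\beta\in(0,1/2)$, let $\alpha_m^G$ be the largest $p\in(0,1)$ with $\mathsf B(m-l_m,p;\kappa_m)\le\alpha$, and $\beta_m^G$ the largest $p\in(0,1)$ with $\mathsf B(u_m,p;\iota_m)\le\beta$ (these are the individual levels that correspond to controlling at $\alpha$ and $\beta$ the probabilities of at least $\kappa_m$ type-I errors and of at least $\iota_m$ type-II errors when the same test is applied to $m$ independent streams, of which at least $l_m$ and at most $u_m$ are signals). Positive quantities satisfy $x_m(s)\sim y_m(s)$ uniformly in $s\in\{l_m,\dots,u_m\}$ if $\max_{l_m\le s\le u_m}|x_m(s)/y_m(s)-1|\to0$ as $m\to\infty$, and $x_m\ll y_m$ means $x_m/y_m\to0$. Let $\chi^*=\{(T^*(\alpha,\beta),D^*(\alpha,\beta))\in\mathcal E(\alpha,\beta):\alpha,\beta\in(0,1)\}$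 be a family of tests. It is called *asymptotically optimal in the high-dimensional sense under generalized error control* if, for all $\alpha,\beta\in(0,1/2)$, $\mathsf E_{s/m}[T^*(\alpha_m^G,\beta_m^G)]\sim\mathcal L_{s/m}(\alpha_m^G,\beta_m^G)$ uniformly in $s\in\{l_m,\dots,u_m\}$. **Theorem.** Suppose that, as $m\to\infty$, $u_m\to\infty$, $m-l_m\to\infty$, $\iota_m\ll u_m$ and $\kappa_m\ll m-l_m$. (i) For all $\alpha,\beta\in(0,1/2)$, uniformly in $s\in\{l_m,\dots,u_m\}$, $$\mathcal L_{s/m}(\alpha_m^G,\beta_m^G)\sim\Big(1-\frac sm\Big)\frac{\log(u_m/\iota_m)}{I_0}+\frac sm\,\frac{\log((m-l_m)/\kappa_m)}{I_1}.$$ (ii) If, for all $\alpha,\beta\in(0,1/2)$, $\mathsf E_0[T^*(\alpha_m^G,\beta_m^G)]\sim\mathcal L_0(\alpha_m^G,\beta_m^G)$ and $\mathsf E_1[T^*(\alpha_m^G,\beta_m^G)]\sim\mathcal L_1(\alpha_m^G,\beta_m^G)$, then $\chi^*$ is asymptotically optimal in the high-dimensional sense under generalized error control. (iii) If, for all $\alpha,\beta\in(0,1/2)$,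 $\mathsf E_0[T^*(\alpha_m^G,\beta_m^G)]\sim\mathcal L_0(\alpha_m^G,\beta_m^G)$ and $$\mathsf E_1[T^*(\alpha_m^G,\beta_m^G)]\ll\frac{(m-u_m)\log(u_m/\iota_m)}{u_m}$$ (in particular $u_m<m$ for all large $m$), then $\chi^*$ is asymptotically optimal in the high-dimensional sense under generalized error control. -/

import Mathlib

open MeasureTheory Filter Topology
open scoped ENNReal

noncomputable section

/-- The `σ`-algebra generated by the first `n` observations of a sequence `ω 0, ω 1, …`
(the `n`-th observation of the sequence is `ω (n - 1)`). -/
abbrev obsSigma (E : Type*) [MeasurableSpace E] (n : ℕ) : MeasurableSpace (ℕ → E) :=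
  ⨆ i : Fin n, MeasurableSpace.comap (fun ω : ℕ → E => ω i) inferInstance

/-- A sequential test: a stopping time `T` with values in `{1, 2, …} ∪ {∞}` and a binary random
variable `D` (`true` means that the null hypothesis is rejected) that is determined by the
observations collected up to time `T`. -/
structure SeqTest (E : Type*) [MeasurableSpace E] where
  T : (ℕ → E) → ℕ∞
  D : (ℕ → E) → Bool
  one_le_T : ∀ ω, 1 ≤ T ω
  measurable_D : Measurable D
  measurableSet_T : ∀ n : ℕ, 1 ≤ n → MeasurableSet[obsSigma E n] {ω | T ω = n}
  measurableSet_T_D : ∀ n : ℕ, 1 ≤ n → ∀ i : Bool,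
    MeasurableSet[obsSigma E n] {ω | T ω = n ∧ D ω = i}

/-- The law of an iid sequence with common law `μ`. -/
def iidLaw {E : Type*} [MeasurableSpace E] (μ : Measure E) [IsProbabilityMeasure μ] :
    Measure (ℕ → E) :=
  Measure.infinitePi (fun _ : ℕ => μ)

/-- The mixture `(1 - π) P₀ + π P₁` of the laws of the iid sequences with marginals `μ₀`, `μ₁`. -/
def mixLaw {E : Type*} [MeasurableSpace E] (μ₀ μ₁ : Measure E) [IsProbabilityMeasure μ₀]
    [IsProbabilityMeasure μ₁] (π : ℝ) : Measure (ℕ → E) :=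
  ENNReal.ofReal (1 - π) • iidLaw μ₀ + ENNReal.ofReal π • iidLaw μ₁

/-- The expected sample size of a test when the sequence of observations has law `Q`. -/
def SeqTest.ess {E : Type*} [MeasurableSpace E] (χ : SeqTest E) (Q : Measure (ℕ → E)) : ℝ≥0∞ :=
  ∫⁻ ω, (χ.T ω : ℝ≥0∞) ∂Q

/-- The class of tests of `μ₀` against `μ₁` with type-I error probability at most `α` and type-II
error probability at most `β`. -/
def testClass {E : Type*} [MeasurableSpace E] (μ₀ μ₁ : Measure E) [IsProbabilityMeasure μ₀]
    [IsProbabilityMeasure μ₁] (α β : ℝ) : Set (SeqTest E) :=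
  {χ | iidLaw μ₀ {ω | χ.D ω = true} ≤ ENNReal.ofReal α ∧
    iidLaw μ₁ {ω | χ.D ω = false} ≤ ENNReal.ofReal β}

/-- The optimal expected sample size under `Q` among the tests in `testClass μ₀ μ₁ α β`. -/
def optESS {E : Type*} [MeasurableSpace E] (μ₀ μ₁ : Measure E) [IsProbabilityMeasure μ₀]
    [IsProbabilityMeasure μ₁] (Q : Measure (ℕ → E)) (α β : ℝ) : ℝ≥0∞ :=
  ⨅ χ ∈ testClass μ₀ μ₁ α β, χ.ess Q

/-- The probability that a binomial random variable with parameters `n`, `p` is at least `k`. -/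
def binomTail (n : ℕ) (p : ℝ) (k : ℕ) : ℝ :=
  ∑ j ∈ Finset.Icc k n, (n.choose j : ℝ) * p ^ j * (1 - p) ^ (n - j)

/-- The largest `p ∈ (0, 1)` such that `binomTail n p k ≤ α`; see `isGreatest_binomLevel`. -/
def binomLevel (n k : ℕ) (α : ℝ) : ℝ :=
  sSup {p : ℝ | p ∈ Set.Ioo (0 : ℝ) 1 ∧ binomTail n p k ≤ α}

theorem isGreatest_binomLevel (n k : ℕ) (α : ℝ) (hk : 1 ≤ k) (hkn : k ≤ n)
    (hα : α ∈ Set.Ioo (0 : ℝ) 1) :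
    IsGreatest {p : ℝ | p ∈ Set.Ioo (0 : ℝ) 1 ∧ binomTail n p k ≤ α} (binomLevel n k α) := by
  have hc : Continuous fun p : ℝ => binomTail n p k := by
    unfold binomTail; fun_prop
  have h0 : binomTail n 0 k = 0 := by
    unfold binomTail
    refine Finset.sum_eq_zero fun j hj => ?_
    have : j ≠ 0 := by have := (Finset.mem_Icc.1 hj).1; omega
    simp [this]
  have h1 : binomTail n 1 k = 1 := by
    unfold binomTail
    rw [Finset.sum_eq_single n]
    · simp
    · intro j hj hjn
      have : n - j ≠ 0 := by have := (Finset.mem_Icc.1 hj).2; omega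
      simp [this]
    · intro h; exact absurd (Finset.mem_Icc.2 ⟨hkn, le_rfl⟩) h
  have hcomp : IsCompact (Set.Icc (0 : ℝ) 1 ∩ {p | binomTail n p k ≤ α}) :=
    isCompact_Icc.inter_right (isClosed_le hc continuous_const)
  obtain ⟨q, ⟨hq01, hq⟩, hmax⟩ := hcomp.exists_isGreatest
    ⟨0, ⟨le_rfl, zero_le_one⟩, by simp [h0, hα.1.le]⟩
  have hsmall : ∃ p ∈ Set.Ioo (0 : ℝ) 1, binomTail n p k ≤ α := by
    have h2 : ∀ᶠ p in 𝓝[>] (0 : ℝ), binomTail n p k < α :=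
      (hc.continuousAt.tendsto.mono_left nhdsWithin_le_nhds).eventually_lt_const
        (by rw [h0]; exact hα.1)
    have h3 : ∀ᶠ p in 𝓝[>] (0 : ℝ), p ∈ Set.Ioo (0 : ℝ) 1 := Ioo_mem_nhdsGT one_pos
    obtain ⟨p, hp, hp'⟩ := (h2.and h3).exists
    exact ⟨p, hp', hp.le⟩
  have hgr : IsGreatest {p : ℝ | p ∈ Set.Ioo (0 : ℝ) 1 ∧ binomTail n p k ≤ α} q := by
    refine ⟨⟨⟨?_, lt_of_le_of_ne hq01.2 ?_⟩, hq⟩, ?_⟩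
    · obtain ⟨p, hp, hp'⟩ := hsmall
      exact hp.1.trans_le (hmax ⟨⟨hp.1.le, hp.2.le⟩, hp'⟩)
    · rintro rfl
      have : binomTail n 1 k ≤ α := hq
      rw [h1] at this
      exact absurd hα.2 (not_lt.2 this)
    · rintro p ⟨hp, hp'⟩
      exact hmax ⟨⟨hp.1.le, hp.2.le⟩, hp'⟩
  rw [binomLevel, hgr.csSup_eq]
  exact hgr

/-- `x m s ∼ y m s` as `m → ∞`, uniformly in `s ∈ {l m, …, u m}`. -/
def UnifEquiv (l u : ℕ → ℕ) (x y : ℕ → ℕ → ℝ≥0∞) : Prop :=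
  ∀ ε : ℝ, 0 < ε → ∀ᶠ m in atTop, ∀ s : ℕ, l m ≤ s → s ≤ u m →
    ENNReal.ofReal (1 - ε) ≤ x m s / y m s ∧ x m s / y m s ≤ ENNReal.ofReal (1 + ε)

/-- The level `α_m^G` for the type-I error of each individual test, for the control at level `α`
of the probability of at least `κ m` type-I errors. -/
def alphaG (l κ : ℕ → ℕ) (α : ℝ) (m : ℕ) : ℝ := binomLevel (m - l m) (κ m) α

/-- The level `β_m^G` for the type-II error of each individual test, for the control at level `β`
of the probability of at least `ι m` type-II errors. -/
def betaG (u ι : ℕ → ℕ) (β : ℝ) (m : ℕ) : ℝ := binomLevel (u m) (ι m) β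

/-- Asymptotic optimality of a family of tests in the high-dimensional sense under generalized
error control. -/
def HighDimOptimal {E : Type*} [MeasurableSpace E] (μ₀ μ₁ : Measure E) [IsProbabilityMeasure μ₀]
    [IsProbabilityMeasure μ₁] (l u κ ι : ℕ → ℕ) (χ : ℝ → ℝ → SeqTest E) : Prop :=
  ∀ α ∈ Set.Ioo (0 : ℝ) (1 / 2), ∀ β ∈ Set.Ioo (0 : ℝ) (1 / 2),
    UnifEquiv l u
      (fun m s => (χ (alphaG l κ α m) (betaG u ι β m)).ess (mixLaw μ₀ μ₁ ((s : ℝ) / m)))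
      (fun m s => optESS μ₀ μ₁ (mixLaw μ₀ μ₁ ((s : ℝ) / m)) (alphaG l κ α m) (betaG u ι β m))

end

/-!
Lower bound: let `Λ` be the log-likelihood ratio walk. Integrating a tangent line of the exponential
on `{D = 0}` and another one on `{D = 1}` against Wald's likelihood ratio identity
`P₁(A) = E₀[exp (-Λ_T); A]` gives `E₀[Λ_T] ≥ (1 - α) log (1 / β) - 1` for every test with error
probabilities at most `α` and `β`, and `E₀[Λ_T] = I₀ E₀[T]` by Wald's identity; symmetrically under
`P₁`. The sequential probability ratio test with boundaries `-log (1 / α)` and `log (1 / β)` attains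
both bounds simultaneously to first order. Since `E_π[T]` is a convex combination of `E₀[T]` and
`E₁[T]`, the optimal value under a mixture is then, to first order and uniformly in `π`, the same
convex combination of the optimal values under `P₀` and `P₁`.

By the inequalities of Markov and Chebyshev the binomial levels are of the exact order of
`κ / (m - l)` and `ι / u`, so their negative logarithms are asymptotic to `log ((m - l) / κ)` and
`log (u / ι)`. In part (iii) the bound `s ≤ u` makes `(s / m) E₁[T]` negligible with respect to
`(1 - s / m) log (u / ι)`, hence with respect to the optimal value.
-/

section Observations

variable {E : Type*} [MeasurableSpace E]

theorem obsSigma_le (n : ℕ) : obsSigma E n ≤ MeasurableSpace.pi :=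
  iSup_le fun i => (measurable_pi_apply (i : ℕ)).comap_le

theorem obsSigma_mono : Monotone (obsSigma E) := fun _ _ h =>
  iSup_le fun i => le_iSup_of_le (Fin.castLE h i) le_rfl

/-- The filtration generated by the observations: `obsSigma` bundled as a Mathlib filtration, so
that the library's stopping times and optional sampling theorem apply. -/
def obsFiltration (E : Type*) [MeasurableSpace E] :
    Filtration ℕ (MeasurableSpace.pi : MeasurableSpace (ℕ → E)) where
  seq := obsSigma E
  mono' := obsSigma_mono
  le' := obsSigma_le

theorem obsSigma_eq_comap (n : ℕ) :
    obsSigma E n = MeasurableSpace.comap (fun (ω : ℕ → E) (i : Fin n) => ω i) inferInstance := by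
  simp only [obsSigma, MeasurableSpace.pi, MeasurableSpace.comap_iSup,
    MeasurableSpace.comap_comp]
  rfl

theorem measurable_eval_obsSigma {i n : ℕ} (h : i < n) :
    Measurable[obsSigma E n] fun ω : ℕ → E => ω i :=
  Measurable.mono (comap_measurable _) (le_iSup_of_le (⟨i, h⟩ : Fin n) le_rfl) le_rfl

variable (μ : Measure E) [IsProbabilityMeasure μ]

instance isProbabilityMeasure_iidLaw : IsProbabilityMeasure (iidLaw μ) := by
  unfold iidLaw; infer_instance

theorem measurePreserving_eval_iidLaw (n : ℕ) :
    MeasurePreserving (fun ω : ℕ → E => ω n) (iidLaw μ) μ :=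
  measurePreserving_eval_infinitePi (fun _ : ℕ => μ) n

theorem iidLaw_map_restrict (n : ℕ) :
    (iidLaw μ).map (fun ω (i : Fin n) => ω i) = Measure.pi fun _ : Fin n => μ := by
  unfold iidLaw
  rw [Measure.map_infinitePi_infinitePi_of_inj (P := fun _ : ℕ => μ)
    (f := fun i : Fin n => (i : ℕ)) Fin.val_injective, Measure.infinitePi_eq_pi]

theorem indep_obsSigma_comap_eval (n : ℕ) :
    ProbabilityTheory.Indep (obsSigma E n)
      (MeasurableSpace.comap (fun ω : ℕ → E => ω n) inferInstance) (iidLaw μ) := by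
  have h_indep : ProbabilityTheory.iIndepFun (fun (i : ℕ) (ω : ℕ → E) => ω i) (iidLaw μ) :=
    ProbabilityTheory.iIndepFun_infinitePi (X := fun _ x => x) fun _ => measurable_id
  have h_past := ProbabilityTheory.indep_iSup_of_disjoint
    (fun i => (measurable_pi_apply i).comap_le) h_indep.iIndep
    (show Disjoint (Set.Iio n) {n} by simp)
  simp only [Set.mem_singleton_iff, iSup_iSup_eq_left] at h_past
  exact ProbabilityTheory.indep_of_indep_of_le_left h_past
    (iSup_le fun i => le_iSup₂_of_le (i : ℕ) i.2 le_rfl)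

theorem setIntegral_eval_eq_mul {Z : E → ℝ} (hZ : Measurable Z) {n : ℕ} {A : Set (ℕ → E)}
    (hA : MeasurableSet[obsSigma E n] A) :
    ∫ ω in A, Z (ω n) ∂iidLaw μ = (iidLaw μ).real A * ∫ x, Z x ∂μ := by
  rw [ProbabilityTheory.Indep.setIntegral_eq_mul (obsSigma_le n) (indep_obsSigma_comap_eval μ n)
    (measurable_pi_apply n).aemeasurable hA hZ.aestronglyMeasurable,
    ← integral_map (φ := fun ω : ℕ → E => ω n) (measurable_pi_apply n).aemeasurable
      hZ.aestronglyMeasurable, (measurePreserving_eval_iidLaw μ n).map_eq]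

end Observations

section ChangeOfMeasure

theorem pi_withDensity {ι : Type*} [Fintype ι] {X : ι → Type*} [∀ i, MeasurableSpace (X i)]
    (μ : ∀ i, Measure (X i)) [∀ i, IsProbabilityMeasure (μ i)] {g : ∀ i, X i → ℝ≥0∞}
    (hg : ∀ i, Measurable (g i)) [∀ i, SigmaFinite ((μ i).withDensity (g i))] :
    (Measure.pi fun i => (μ i).withDensity (g i)) =
      (Measure.pi μ).withDensity fun x => ∏ i, g i (x i) := by
  refine Measure.pi_eq fun s hs => ?_
  have h_ind (x : ∀ i, X i) : (Set.univ.pi s).indicator (fun x => ∏ i, g i (x i)) x =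
      ∏ i, (s i).indicator (g i) (x i) := by
    by_cases hx : ∀ i, x i ∈ s i
    · simp [hx]
    · rw [Set.indicator_of_notMem (by simpa using hx)]
      obtain ⟨i, hi⟩ := not_forall.1 hx
      exact (Finset.prod_eq_zero (Finset.mem_univ i) (Set.indicator_of_notMem hi _)).symm
  rw [withDensity_apply _ (MeasurableSet.univ_pi hs),
    ← lintegral_indicator (MeasurableSet.univ_pi hs), lintegral_congr h_ind,
    ProbabilityTheory.lintegral_prod_eq_prod_lintegral_of_indepFun Finset.univ
      (fun i (x : ∀ i, X i) => (s i).indicator (g i) (x i))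
      (ProbabilityTheory.iIndepFun_pi fun i => ((hg i).indicator (hs i)).aemeasurable)
      fun i => ((hg i).indicator (hs i)).comp (measurable_pi_apply i)]
  refine Finset.prod_congr rfl fun i _ => ?_
  rw [withDensity_apply _ (hs i), ← lintegral_indicator (hs i)]
  exact (measurePreserving_eval μ i).lintegral_comp ((hg i).indicator (hs i))

variable {E : Type*} [MeasurableSpace E] {μ₀ μ₁ : Measure E} [IsProbabilityMeasure μ₀]
  [IsProbabilityMeasure μ₁]

theorem iidLaw_apply_eq_setLIntegral_prod {g : E → ℝ≥0∞} (hg : Measurable g)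
    (h : μ₁ = μ₀.withDensity g) {n : ℕ} {A : Set (ℕ → E)} (hA : MeasurableSet[obsSigma E n] A) :
    iidLaw μ₁ A = ∫⁻ ω in A, ∏ i : Fin n, g (ω i) ∂iidLaw μ₀ := by
  have h_restrict : Measurable fun (ω : ℕ → E) (i : Fin n) => ω i := by fun_prop
  have : SigmaFinite (μ₀.withDensity g) := h ▸ inferInstance
  rw [obsSigma_eq_comap] at hA
  obtain ⟨B, hB, rfl⟩ := hA
  rw [← Measure.map_apply h_restrict hB, iidLaw_map_restrict]
  simp_rw [h]
  rw [pi_withDensity _ fun _ => hg, withDensity_apply _ hB, ← iidLaw_map_restrict,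
    setLIntegral_map hB (by fun_prop) h_restrict]

end ChangeOfMeasure

section RandomWalk

/-- The random walk with steps `Z (ω 0), Z (ω 1), …`; for `Z` a log-likelihood ratio it is the
log-likelihood ratio process of the observations. -/
def walk {E : Type*} (Z : E → ℝ) (n : ℕ) (ω : ℕ → E) : ℝ :=
  ∑ i ∈ Finset.range n, Z (ω i)

theorem walk_neg {E : Type*} (Z : E → ℝ) (n : ℕ) (ω : ℕ → E) : walk (-Z) n ω = -walk Z n ω := by
  simp [walk]

theorem stoppedValue_of_eq {Ω β : Type*} {u : ℕ → Ω → β} {τ : Ω → ℕ∞} {ω : Ω} {n : ℕ}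
    (h : τ ω = n) : stoppedValue u τ ω = u n ω := by
  simp [stoppedValue, h]

theorem measurable_of_isStoppingTime {Ω : Type*} {mΩ : MeasurableSpace Ω} {ℱ : Filtration ℕ mΩ}
    {τ : Ω → ℕ∞} (hτ : IsStoppingTime ℱ τ) : Measurable τ := by
  refine measurable_to_countable' fun t => ?_
  induction t using ENat.recTopCoe with
  | top => exact hτ.measurableSet_eq_top
  | coe n => exact ℱ.le n _ (hτ.measurableSet_eq n)

variable {E : Type*} [MeasurableSpace E] {Z : E → ℝ}

theorem stronglyAdapted_walk (hZ : Measurable Z) :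
    StronglyAdapted (obsFiltration E) (walk Z) := fun n => by
  refine Measurable.stronglyMeasurable (Finset.measurable_fun_sum _ fun i hi => ?_)
  exact hZ.comp (measurable_eval_obsSigma (Finset.mem_range.1 hi))

variable {μ : Measure E} [IsProbabilityMeasure μ]

theorem integrable_walk (hZ : Integrable Z μ) (n : ℕ) : Integrable (walk Z n) (iidLaw μ) :=
  integrable_finsetSum _ fun i _ =>
    (measurePreserving_eval_iidLaw μ i).integrable_comp_of_integrable hZ

theorem martingale_walk_sub_mul_integral (hZm : Measurable Z) (hZ : Integrable Z μ) :
    Martingale (fun n ω => walk Z n ω - n * ∫ x, Z x ∂μ) (obsFiltration E) (iidLaw μ) := by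
  have h_int (n : ℕ) : Integrable (fun ω => walk Z n ω - n * ∫ x, Z x ∂μ) (iidLaw μ) :=
    (integrable_walk hZ n).sub (integrable_const _)
  refine martingale_of_setIntegral_eq_succ
    (fun n => (stronglyAdapted_walk hZm n).sub stronglyMeasurable_const) h_int fun n A hA => ?_
  have h_step : Integrable (fun ω : ℕ → E => Z (ω n)) (iidLaw μ) :=
    (measurePreserving_eval_iidLaw μ n).integrable_comp_of_integrable hZ
  have h_succ (ω : ℕ → E) : walk Z (n + 1) ω - (n + 1 : ℕ) * ∫ x, Z x ∂μ =
      (walk Z n ω - n * ∫ x, Z x ∂μ) + (Z (ω n) - ∫ x, Z x ∂μ) := by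
    rw [walk, Finset.sum_range_succ, ← walk]
    push_cast
    ring
  have h_centred : ∫ ω in A, (Z (ω n) - ∫ x, Z x ∂μ) ∂iidLaw μ = 0 := by
    rw [integral_sub h_step.integrableOn (integrable_const _).integrableOn,
      setIntegral_eval_eq_mul μ hZm hA, setIntegral_const, smul_eq_mul, sub_self]
  simp only [h_succ]
  have h_step_sub : IntegrableOn (fun ω : ℕ → E => Z (ω n) - ∫ x, Z x ∂μ) A (iidLaw μ) :=
    (h_step.sub (integrable_const _)).integrableOn
  rw [integral_add (h_int n).integrableOn h_step_sub, h_centred, add_zero]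

/-- **Wald's identity**. -/
theorem integral_stoppedValue_walk (hZm : Measurable Z)
    (hZ : Integrable Z μ) {τ : (ℕ → E) → ℕ∞} (hτ : IsStoppingTime (obsFiltration E) τ) {N : ℕ}
    (hN : ∀ ω, τ ω ≤ N) :
    ∫ ω, stoppedValue (walk Z) τ ω ∂iidLaw μ =
      (∫⁻ ω, (τ ω : ℝ≥0∞) ∂iidLaw μ).toReal * ∫ x, Z x ∂μ := by
  have h_mart := martingale_walk_sub_mul_integral hZm hZ
  have h_zero : ∫ ω, stoppedValue (fun n ω => walk Z n ω - n * ∫ x, Z x ∂μ) τ ω ∂iidLaw μ = 0 := by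
    rw [integral_congr_ae (h_mart.stoppedValue_ae_eq_condExp_of_le_const hτ hN),
      integral_condExp hτ.measurableSpace_le, ← setIntegral_univ,
      ← h_mart.setIntegral_eq N.zero_le MeasurableSet.univ]
    simp [walk]
  have h_ne_top (ω : ℕ → E) : τ ω ≠ ⊤ := ne_top_of_le_ne_top (ENat.natCast_ne_top N) (hN ω)
  have h_sub (ω : ℕ → E) : stoppedValue (walk Z) τ ω =
      stoppedValue (fun n ω => walk Z n ω - n * ∫ x, Z x ∂μ) τ ω +
        (τ ω : ℝ≥0∞).toReal * ∫ x, Z x ∂μ := by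
    obtain ⟨n, hn⟩ := ENat.ne_top_iff_exists.1 (h_ne_top ω)
    rw [stoppedValue_of_eq hn.symm, stoppedValue_of_eq hn.symm, ← hn]
    simp
  have h_meas : Measurable fun ω => (τ ω : ℝ≥0∞) := by
    have := measurable_of_isStoppingTime hτ
    fun_prop
  have h_bdd : Integrable (fun ω => (τ ω : ℝ≥0∞).toReal) (iidLaw μ) :=
    Integrable.of_bound h_meas.ennreal_toReal.aestronglyMeasurable N (ae_of_all _ fun ω => by
      obtain ⟨n, hn⟩ := ENat.ne_top_iff_exists.1 (h_ne_top ω)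
      have := hN ω
      rw [← hn] at this ⊢
      simpa using this)
  simp only [h_sub]
  rw [integral_add (integrable_stoppedValue ℕ hτ h_mart.integrable hN) (h_bdd.mul_const _),
    h_zero, zero_add, integral_mul_const, integral_toReal h_meas.aemeasurable
    (ae_of_all _ fun ω => by simpa using lt_top_iff_ne_top.2 (h_ne_top ω))]

end RandomWalk

section LikelihoodRatio

open InformationTheory

/-- `Z` is a version of the log-likelihood ratio `log (dμ₀/dμ₁)` of mutually absolutely continuous
measures, encoded by `dμ₁/dμ₀ = exp (-Z)` everywhere. -/
structure IsLLR {E : Type*} [MeasurableSpace E] (Z : E → ℝ) (μ₀ μ₁ : Measure E) : Prop where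
  measurable : Measurable Z
  eq_withDensity : μ₁ = μ₀.withDensity fun x => ENNReal.ofReal (Real.exp (-Z x))

variable {E : Type*} [MeasurableSpace E] {μ₀ μ₁ : Measure E}

theorem IsLLR.symm {Z : E → ℝ} (h : IsLLR Z μ₀ μ₁) : IsLLR (-Z) μ₁ μ₀ := by
  have hZ := h.measurable
  refine ⟨hZ.neg, ?_⟩
  rw [h.eq_withDensity, ← withDensity_mul _ (by fun_prop) (by fun_prop)]
  conv_lhs => rw [← withDensity_one (μ := μ₀)]
  congr 1
  ext x
  simp [← ENNReal.ofReal_mul (Real.exp_pos _).le, ← Real.exp_add]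

theorem isLLR_llr [IsFiniteMeasure μ₀] [IsFiniteMeasure μ₁] (h₀₁ : μ₀ ≪ μ₁) (h₁₀ : μ₁ ≪ μ₀) :
    IsLLR (llr μ₀ μ₁) μ₀ μ₁ := by
  refine ⟨measurable_llr μ₀ μ₁, ?_⟩
  conv_lhs => rw [← Measure.withDensity_rnDeriv_eq μ₁ μ₀ h₁₀]
  refine withDensity_congr_ae ?_
  filter_upwards [exp_neg_llr h₀₁, Measure.rnDeriv_ne_top μ₁ μ₀] with x hx hx'
  rw [hx, ENNReal.ofReal_toReal hx']

variable [IsProbabilityMeasure μ₀] [IsProbabilityMeasure μ₁]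

theorem integrable_llr_and_integral_eq_of_klDiv_eq {I : ℝ} (hI : 0 ≤ I)
    (h : klDiv μ₀ μ₁ = ENNReal.ofReal I) :
    Integrable (llr μ₀ μ₁) μ₀ ∧ ∫ x, llr μ₀ μ₁ x ∂μ₀ = I := by
  obtain ⟨h_ac, h_int⟩ := klDiv_ne_top_iff.1 (h ▸ ENNReal.ofReal_ne_top)
  exact ⟨h_int, by rw [← toReal_klDiv_of_measure_eq h_ac (by simp), h, ENNReal.toReal_ofReal hI]⟩

theorem exists_isLLR_of_klDiv_eq {I₀ I₁ : ℝ} (hI₀ : 0 ≤ I₀) (hI₁ : 0 ≤ I₁)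
    (h₀ : klDiv μ₀ μ₁ = ENNReal.ofReal I₀) (h₁ : klDiv μ₁ μ₀ = ENNReal.ofReal I₁) :
    ∃ Z : E → ℝ, IsLLR Z μ₀ μ₁ ∧ (Integrable Z μ₀ ∧ ∫ x, Z x ∂μ₀ = I₀) ∧
      Integrable (-Z) μ₁ ∧ ∫ x, (-Z) x ∂μ₁ = I₁ := by
  have h₀₁ := (klDiv_ne_top_iff.1 (h₀ ▸ ENNReal.ofReal_ne_top)).1
  have h₁₀ := (klDiv_ne_top_iff.1 (h₁ ▸ ENNReal.ofReal_ne_top)).1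
  have h_neg : -llr μ₀ μ₁ =ᵐ[μ₁] llr μ₁ μ₀ := h₁₀.ae_eq (neg_llr h₀₁)
  obtain ⟨h_int, h_eq⟩ := integrable_llr_and_integral_eq_of_klDiv_eq hI₁ h₁
  exact ⟨llr μ₀ μ₁, isLLR_llr h₀₁ h₁₀, integrable_llr_and_integral_eq_of_klDiv_eq hI₀ h₀,
    h_int.congr h_neg.symm, (integral_congr_ae h_neg).trans h_eq⟩

variable {Z : E → ℝ}

theorem iidLaw_apply_eq_setLIntegral_exp_neg_walk (h : IsLLR Z μ₀ μ₁) {n : ℕ} {A : Set (ℕ → E)}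
    (hA : MeasurableSet[obsSigma E n] A) :
    iidLaw μ₁ A = ∫⁻ ω in A, ENNReal.ofReal (Real.exp (-walk Z n ω)) ∂iidLaw μ₀ := by
  have hZ := h.measurable
  rw [iidLaw_apply_eq_setLIntegral_prod (by fun_prop) h.eq_withDensity hA]
  refine lintegral_congr fun ω => ?_
  rw [← ENNReal.ofReal_prod_of_nonneg fun i _ => (Real.exp_pos _).le, ← Real.exp_sum,
    Finset.sum_neg_distrib, walk, Finset.sum_range]

variable {τ : (ℕ → E) → ℕ∞} {A : Set (ℕ → E)}

/-- **Wald's likelihood ratio identity**. -/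
theorem iidLaw_inter_ne_top_eq_setLIntegral (h : IsLLR Z μ₀ μ₁)
    (hτ : IsStoppingTime (obsFiltration E) τ) (hA : MeasurableSet[hτ.measurableSpace] A) :
    iidLaw μ₁ (A ∩ {ω | τ ω ≠ ⊤}) = ∫⁻ ω in A ∩ {ω | τ ω ≠ ⊤},
      ENNReal.ofReal (Real.exp (-stoppedValue (walk Z) τ ω)) ∂iidLaw μ₀ := by
  have h_iUnion : A ∩ {ω | τ ω ≠ ⊤} = ⋃ n : ℕ, A ∩ {ω | τ ω = n} := by
    ext ω
    simp [ENat.ne_top_iff_exists, eq_comm]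
  have h_meas (n : ℕ) : MeasurableSet[obsSigma E n] (A ∩ {ω | τ ω = n}) :=
    (hτ.measurableSet_inter_eq_iff A n).1 (hA.inter (hτ.measurableSet_eq' n))
  have h_disj : Pairwise (Function.onFun Disjoint fun n : ℕ => A ∩ {ω | τ ω = n}) :=
    fun i j hij => Set.disjoint_left.2 fun ω hi hj => hij (by exact_mod_cast hi.2.symm.trans hj.2)
  have h_meas' (n : ℕ) : MeasurableSet (A ∩ {ω | τ ω = n}) := obsSigma_le n _ (h_meas n)
  rw [h_iUnion, measure_iUnion h_disj h_meas', lintegral_iUnion h_meas' h_disj]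
  refine tsum_congr fun n => ?_
  rw [iidLaw_apply_eq_setLIntegral_exp_neg_walk h (h_meas n)]
  refine setLIntegral_congr_fun (h_meas' n) fun ω hω => ?_
  rw [stoppedValue_of_eq hω.2]

theorem iidLaw_inter_ne_top_le_exp_neg (h : IsLLR Z μ₀ μ₁)
    (hτ : IsStoppingTime (obsFiltration E) τ) (hA : MeasurableSet[hτ.measurableSpace] A) {b : ℝ}
    (hb : ∀ ω ∈ A, τ ω ≠ ⊤ → b ≤ stoppedValue (walk Z) τ ω) :
    iidLaw μ₁ (A ∩ {ω | τ ω ≠ ⊤}) ≤ ENNReal.ofReal (Real.exp (-b)) :=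
  calc iidLaw μ₁ (A ∩ {ω | τ ω ≠ ⊤})
      = ∫⁻ ω in A ∩ {ω | τ ω ≠ ⊤},
          ENNReal.ofReal (Real.exp (-stoppedValue (walk Z) τ ω)) ∂iidLaw μ₀ :=
        iidLaw_inter_ne_top_eq_setLIntegral h hτ hA
    _ ≤ ∫⁻ _ in A ∩ {ω | τ ω ≠ ⊤}, ENNReal.ofReal (Real.exp (-b)) ∂iidLaw μ₀ := by
        refine setLIntegral_mono measurable_const fun ω hω => ?_
        have := hb ω hω.1 hω.2
        gcongr
    _ ≤ ENNReal.ofReal (Real.exp (-b)) := by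
        rw [setLIntegral_const]
        exact mul_le_of_le_one_right' prob_le_one

end LikelihoodRatio

section LowerBound

theorem add_one_mul_measureReal_sub_setIntegral_le {Ω : Type*} [MeasurableSpace Ω]
    {P Q : Measure Ω} [IsFiniteMeasure P] [IsFiniteMeasure Q] {X : Ω → ℝ} (hX : Integrable X P)
    {B : Set Ω} (hB : Q B = ∫⁻ ω in B, ENNReal.ofReal (Real.exp (-X ω)) ∂P) (c : ℝ) :
    (c + 1) * P.real B - ∫ ω in B, X ω ∂P ≤ Real.exp c * Q.real B := by
  have h_meas : AEStronglyMeasurable (fun ω => Real.exp (-X ω)) (P.restrict B) :=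
    Real.continuous_exp.comp_aestronglyMeasurable hX.neg.aestronglyMeasurable.restrict
  have h_nonneg : 0 ≤ᵐ[P.restrict B] fun ω => Real.exp (-X ω) :=
    ae_of_all _ fun _ => (Real.exp_pos _).le
  have h_exp : IntegrableOn (fun ω => Real.exp (-X ω)) B P :=
    (lintegral_ofReal_ne_top_iff_integrable h_meas h_nonneg).1 (hB ▸ measure_ne_top Q B)
  have h_const : IntegrableOn (fun _ => c + 1) B P := (integrable_const _).integrableOn
  calc (c + 1) * P.real B - ∫ ω in B, X ω ∂P = ∫ ω in B, (c + 1 - X ω) ∂P := by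
        rw [integral_sub h_const hX.integrableOn, setIntegral_const, smul_eq_mul, mul_comm]
    _ ≤ ∫ ω in B, Real.exp c * Real.exp (-X ω) ∂P := by
        refine integral_mono (h_const.sub hX.integrableOn) (h_exp.const_mul _) fun ω => ?_
        have := Real.add_one_le_exp (c + -X ω)
        rw [Real.exp_add] at this
        linarith
    _ = Real.exp c * Q.real B := by
        rw [integral_const_mul, integral_eq_lintegral_of_nonneg_ae h_nonneg h_meas, ← hB]
        rfl

theorem mul_measureReal_le_integral_add {Ω : Type*} [MeasurableSpace Ω] {P Q : Measure Ω}
    [IsProbabilityMeasure P] [IsProbabilityMeasure Q] {X : Ω → ℝ} (hX : Integrable X P)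
    {A : Set Ω} (hA : MeasurableSet A)
    (h : Q A = ∫⁻ ω in A, ENNReal.ofReal (Real.exp (-X ω)) ∂P)
    (h_compl : Q Aᶜ = ∫⁻ ω in Aᶜ, ENNReal.ofReal (Real.exp (-X ω)) ∂P) (c : ℝ) :
    c * P.real A ≤ ∫ ω, X ω ∂P + Real.exp c * Q.real A := by
  have h_A := add_one_mul_measureReal_sub_setIntegral_le hX h c
  have h_Ac := add_one_mul_measureReal_sub_setIntegral_le hX h_compl 0
  rw [Real.exp_zero, probReal_compl_eq_one_sub hA, probReal_compl_eq_one_sub hA] at h_Ac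
  linarith [integral_add_compl hA hX, measureReal_nonneg (μ := Q) (s := A)]

variable {E : Type*} [MeasurableSpace E] {μ₀ μ₁ : Measure E} [IsProbabilityMeasure μ₀]
  [IsProbabilityMeasure μ₁] {Z : E → ℝ}

theorem mul_measureReal_le_of_isStoppingTime_le (h : IsLLR Z μ₀ μ₁) (hZ : Integrable Z μ₀)
    {τ : (ℕ → E) → ℕ∞} (hτ : IsStoppingTime (obsFiltration E) τ) {N : ℕ} (hN : ∀ ω, τ ω ≤ N)
    {A : Set (ℕ → E)} (hA : MeasurableSet[hτ.measurableSpace] A) (c : ℝ) :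
    c * (iidLaw μ₀).real A ≤ (∫⁻ ω, (τ ω : ℝ≥0∞) ∂iidLaw μ₀).toReal * ∫ x, Z x ∂μ₀ +
      Real.exp c * (iidLaw μ₁).real A := by
  have h_ne_top : {ω | τ ω ≠ ⊤} = Set.univ :=
    Set.eq_univ_of_forall fun ω => ne_top_of_le_ne_top (ENat.natCast_ne_top N) (hN ω)
  have h_change {B : Set (ℕ → E)} (hB : MeasurableSet[hτ.measurableSpace] B) :
      iidLaw μ₁ B =
        ∫⁻ ω in B, ENNReal.ofReal (Real.exp (-stoppedValue (walk Z) τ ω)) ∂iidLaw μ₀ := by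
    simpa [h_ne_top] using iidLaw_inter_ne_top_eq_setLIntegral h hτ hB
  rw [← integral_stoppedValue_walk h.measurable hZ hτ hN]
  exact mul_measureReal_le_integral_add (integrable_stoppedValue ℕ hτ (integrable_walk hZ) hN)
    (hτ.measurableSpace_le _ hA) (h_change hA) (h_change hA.compl) c

namespace SeqTest

variable (χ : SeqTest E)

theorem measurableSet_eq_inter (n : ℕ) (i : Bool) :
    MeasurableSet[obsSigma E n] ({ω | χ.D ω = i} ∩ {ω | χ.T ω = n}) := by
  rcases Nat.eq_zero_or_pos n with rfl | hn
  · have h_empty : {ω | χ.D ω = i} ∩ {ω | χ.T ω = (0 : ℕ)} = ∅ :=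
      Set.eq_empty_of_forall_notMem fun ω hω =>
        (zero_lt_one.trans_le (χ.one_le_T ω)).ne' hω.2
    rw [h_empty]
    exact @MeasurableSet.empty _ (obsSigma E 0)
  · rw [Set.inter_comm]
    exact χ.measurableSet_T_D n hn i

theorem isStoppingTime : IsStoppingTime (obsFiltration E) χ.T := by
  refine isStoppingTime_of_measurableSet_eq fun n => ?_
  have h_union : {ω | χ.T ω = n} = ({ω | χ.D ω = true} ∩ {ω | χ.T ω = n}) ∪
      ({ω | χ.D ω = false} ∩ {ω | χ.T ω = n}) := by
    ext ω
    cases h : χ.D ω <;> simp [h]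
  exact h_union ▸ (χ.measurableSet_eq_inter n true).union (χ.measurableSet_eq_inter n false)

theorem measurable_T : Measurable χ.T := measurable_of_isStoppingTime χ.isStoppingTime

theorem measurableSet_D_eq (i : Bool) :
    MeasurableSet[χ.isStoppingTime.measurableSpace] {ω | χ.D ω = i} := by
  have h_iSup : MeasurableSpace.pi ≤ ⨆ n, obsFiltration E n := iSup_le fun n =>
    le_iSup_of_le (n + 1) (measurable_eval_obsSigma n.lt_succ_self).comap_le
  refine ⟨h_iSup _ (χ.measurable_D (measurableSet_singleton i)), fun n => ?_⟩
  have h_union : {ω | χ.D ω = i} ∩ {ω | χ.T ω ≤ n} =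
      ⋃ k ∈ Set.Iic n, {ω | χ.D ω = i} ∩ {ω | χ.T ω = k} := by
    ext ω
    simp only [Set.mem_inter_iff, Set.mem_ofPred_eq, Set.mem_iUnion, Set.mem_Iic,
      ENat.le_natCast_iff]
    grind
  exact h_union ▸ MeasurableSet.biUnion (Set.to_countable _) fun k hk =>
    obsSigma_mono hk _ (χ.measurableSet_eq_inter k i)

variable {χ}

theorem ae_T_ne_top {P : Measure (ℕ → E)} (h_ess : χ.ess P ≠ ⊤) : ∀ᵐ ω ∂P, χ.T ω ≠ ⊤ := by
  have h_meas : Measurable fun ω => (χ.T ω : ℝ≥0∞) := by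
    have := χ.measurable_T
    fun_prop
  filter_upwards [ae_lt_top h_meas h_ess] with ω hω h_top
  simp [h_top] at hω

theorem log_mul_measureReal_inter_le {β : ℝ} (h : IsLLR Z μ₀ μ₁) (hZ : Integrable Z μ₀)
    (hI : 0 ≤ ∫ x, Z x ∂μ₀) (hβ : 0 < β) {i : Bool}
    (h_err : iidLaw μ₁ {ω | χ.D ω = i} ≤ ENNReal.ofReal β)
    (h_ess : χ.ess (iidLaw μ₀) ≠ ⊤) (N : ℕ) :
    Real.log (1 / β) * (iidLaw μ₀).real ({ω | χ.D ω = i} ∩ {ω | χ.T ω ≤ N}) ≤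
      (χ.ess (iidLaw μ₀)).toReal * ∫ x, Z x ∂μ₀ + 1 := by
  have h_stop := χ.isStoppingTime.min_const N
  have h_meas : MeasurableSet[h_stop.measurableSpace] ({ω | χ.D ω = i} ∩ {ω | χ.T ω ≤ N}) :=
    (χ.isStoppingTime.measurableSet_inter_le_const_iff _ N).1
      (MeasurableSet.inter (χ.measurableSet_D_eq i) (χ.isStoppingTime.measurableSet_le' N))
  have h_ess_min : (∫⁻ ω, (min (χ.T ω) N : ℕ∞) ∂iidLaw μ₀).toReal ≤
      (χ.ess (iidLaw μ₀)).toReal :=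
    ENNReal.toReal_mono h_ess <| lintegral_mono fun ω =>
      ENat.toENNReal_mono (min_le_left _ _)
  have h_err_inter : (iidLaw μ₁).real ({ω | χ.D ω = i} ∩ {ω | χ.T ω ≤ N}) ≤ β :=
    ENNReal.toReal_le_of_le_ofReal hβ.le ((measure_mono Set.inter_subset_left).trans h_err)
  calc Real.log (1 / β) * (iidLaw μ₀).real ({ω | χ.D ω = i} ∩ {ω | χ.T ω ≤ N})
      ≤ (∫⁻ ω, (min (χ.T ω) N : ℕ∞) ∂iidLaw μ₀).toReal * ∫ x, Z x ∂μ₀ +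
          Real.exp (Real.log (1 / β)) *
            (iidLaw μ₁).real ({ω | χ.D ω = i} ∩ {ω | χ.T ω ≤ N}) :=
        mul_measureReal_le_of_isStoppingTime_le h hZ h_stop (fun ω => min_le_right _ _) h_meas _
    _ ≤ (χ.ess (iidLaw μ₀)).toReal * ∫ x, Z x ∂μ₀ + 1 := by
        rw [Real.exp_log (by positivity)]
        refine add_le_add (mul_le_mul_of_nonneg_right h_ess_min hI) ?_
        calc 1 / β * _ ≤ 1 / β * β := by gcongr
          _ = 1 := one_div_mul_cancel hβ.ne'

theorem log_mul_measureReal_le {β : ℝ} (h : IsLLR Z μ₀ μ₁) (hZ : Integrable Z μ₀)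
    (hI : 0 ≤ ∫ x, Z x ∂μ₀) (hβ : 0 < β) {i : Bool}
    (h_err : iidLaw μ₁ {ω | χ.D ω = i} ≤ ENNReal.ofReal β)
    (h_ess : χ.ess (iidLaw μ₀) ≠ ⊤) :
    Real.log (1 / β) * (iidLaw μ₀).real {ω | χ.D ω = i} ≤
      (χ.ess (iidLaw μ₀)).toReal * ∫ x, Z x ∂μ₀ + 1 := by
  have h_union : ⋃ N : ℕ, {ω | χ.D ω = i} ∩ {ω | χ.T ω ≤ N} =ᵐ[iidLaw μ₀] {ω | χ.D ω = i} := by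
    filter_upwards [ae_T_ne_top h_ess] with ω hω
    obtain ⟨n, hn⟩ := ENat.ne_top_iff_exists.1 hω
    refine propext ⟨fun hω' => ?_, fun hω' => ?_⟩
    · obtain ⟨N, hN⟩ := Set.mem_iUnion.1 hω'
      exact hN.1
    · exact Set.mem_iUnion.2 ⟨n, hω', hn.ge⟩
  have h_mono : Monotone fun N : ℕ => {ω | χ.D ω = i} ∩ {ω | χ.T ω ≤ N} := fun M N hMN =>
    Set.inter_subset_inter_right _ fun ω (hω : χ.T ω ≤ M) => hω.trans (by exact_mod_cast hMN)
  have h_tendsto := tendsto_measure_iUnion_atTop (μ := iidLaw μ₀) h_mono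
  rw [measure_congr h_union] at h_tendsto
  exact le_of_tendsto' (((ENNReal.tendsto_toReal (measure_ne_top _ _)).comp h_tendsto).const_mul _)
    (log_mul_measureReal_inter_le h hZ hI hβ h_err h_ess)

theorem le_ess {α β : ℝ} (h : IsLLR Z μ₀ μ₁) (hZ : Integrable Z μ₀) (hI : 0 < ∫ x, Z x ∂μ₀)
    (hα : 0 ≤ α) (hβ : β ∈ Set.Ioc (0 : ℝ) 1) {i : Bool}
    (h_err₀ : iidLaw μ₀ {ω | χ.D ω = !i} ≤ ENNReal.ofReal α)
    (h_err₁ : iidLaw μ₁ {ω | χ.D ω = i} ≤ ENNReal.ofReal β) :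
    ENNReal.ofReal (((1 - α) * Real.log (1 / β) - 1) / ∫ x, Z x ∂μ₀) ≤ χ.ess (iidLaw μ₀) := by
  by_cases h_ess : χ.ess (iidLaw μ₀) = ⊤
  · exact h_ess ▸ le_top
  have h_log : 0 ≤ Real.log (1 / β) :=
    Real.log_nonneg ((one_le_div hβ.1).2 hβ.2)
  have h_compl : {ω | χ.D ω = i}ᶜ = {ω | χ.D ω = !i} := by
    ext ω
    exact Bool.eq_not.symm
  have h_prob : 1 - α ≤ (iidLaw μ₀).real {ω | χ.D ω = i} := by
    have h_meas : MeasurableSet {ω | χ.D ω = i} := χ.measurable_D (measurableSet_singleton i)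
    have h_add := probReal_compl_eq_one_sub (μ := iidLaw μ₀) h_meas
    rw [h_compl] at h_add
    have h_le : (iidLaw μ₀).real {ω | χ.D ω = !i} ≤ α :=
      ENNReal.toReal_le_of_le_ofReal hα h_err₀
    linarith
  refine ENNReal.ofReal_le_of_le_toReal ((div_le_iff₀ hI).2 ?_)
  linarith [mul_le_mul_of_nonneg_left h_prob h_log,
    log_mul_measureReal_le h hZ hI.le hβ.1 h_err₁ h_ess]

end SeqTest

end LowerBound

section ExitTime

theorem iSup_min_natCast (t : ℕ∞) : ⨆ N : ℕ, ((min t N : ℕ∞) : ℝ≥0∞) = t := by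
  refine le_antisymm (iSup_le fun N => ENat.toENNReal_mono (min_le_left _ _)) ?_
  induction t using ENat.recTopCoe with
  | top => simp [ENNReal.iSup_natCast]
  | coe n => exact le_iSup_of_le n (by simp)

theorem tendsto_integral_min_natCast {Ω : Type*} [MeasurableSpace Ω] {P : Measure Ω} {X : Ω → ℝ}
    (hX : Integrable X P) :
    Tendsto (fun c : ℕ => ∫ ω, min (X ω) c ∂P) atTop (𝓝 (∫ ω, X ω ∂P)) := by
  refine tendsto_integral_of_dominated_convergence (fun ω => |X ω|)
    (fun c => hX.aestronglyMeasurable.inf aestronglyMeasurable_const) hX.abs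
    (fun c => ae_of_all _ fun ω => ?_) (ae_of_all _ fun ω => ?_)
  · rw [Real.norm_eq_abs, abs_le]
    exact ⟨le_min (neg_abs_le _) ((neg_nonpos.2 (abs_nonneg _)).trans c.cast_nonneg),
      (min_le_left _ _).trans (le_abs_self _)⟩
  · refine tendsto_const_nhds.congr' ?_
    filter_upwards [eventually_ge_atTop ⌈X ω⌉₊] with c hc
    exact (min_eq_left ((Nat.le_ceil _).trans (by exact_mod_cast hc))).symm

theorem walk_min_le {E : Type*} {Z : E → ℝ} {b c : ℝ} (hb : 0 ≤ b) (hc : 0 ≤ c) {n : ℕ}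
    {ω : ℕ → E} (h : ∀ k < n, walk Z k ω ≤ b) : walk (fun x => min (Z x) c) n ω ≤ b + c := by
  rcases n with - | n
  · simpa [walk] using add_nonneg hb hc
  · rw [walk, Finset.sum_range_succ]
    exact add_le_add ((Finset.sum_le_sum fun i _ => min_le_left _ _).trans (h n n.lt_succ_self))
      (min_le_right _ _)

variable {E : Type*} [MeasurableSpace E] {μ : Measure E} [IsProbabilityMeasure μ] {Z : E → ℝ}
  {τ : (ℕ → E) → ℕ∞}

theorem lintegral_min_mul_integral_min_le (hZm : Measurable Z) (hZ : Integrable Z μ)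
    (hτ : IsStoppingTime (obsFiltration E) τ) {b c : ℝ} (hb : 0 ≤ b) (hc : 0 ≤ c)
    (h : ∀ ω, ∀ k : ℕ, k < τ ω → walk Z k ω ≤ b) (N : ℕ) :
    (∫⁻ ω, (min (τ ω) N : ℕ∞) ∂iidLaw μ).toReal * ∫ x, min (Z x) c ∂μ ≤ b + c := by
  have h_int : Integrable (fun x => min (Z x) c) μ := hZ.inf (integrable_const c)
  have h_stop := hτ.min_const N
  have h_le (ω : ℕ → E) :
      stoppedValue (walk fun x => min (Z x) c) (fun ω => min (τ ω) N) ω ≤ b + c := by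
    obtain ⟨n, hn⟩ := ENat.ne_top_iff_exists.1
      (ne_top_of_le_ne_top (ENat.natCast_ne_top N) (min_le_right (τ ω) N))
    have h_eq : stoppedValue (walk fun x => min (Z x) c) (fun ω => min (τ ω) N) ω =
        walk (fun x => min (Z x) c) n ω := stoppedValue_of_eq hn.symm
    refine h_eq.trans_le (walk_min_le hb hc fun k hk => h ω k ?_)
    exact (Nat.cast_lt.2 hk).trans_le (hn.trans_le (min_le_left _ _))
  calc (∫⁻ ω, (min (τ ω) N : ℕ∞) ∂iidLaw μ).toReal * ∫ x, min (Z x) c ∂μ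
      = ∫ ω, stoppedValue (walk fun x => min (Z x) c) (fun ω => min (τ ω) N) ω ∂iidLaw μ :=
        (integral_stoppedValue_walk (hZm.min measurable_const) h_int h_stop
          fun ω => min_le_right _ _).symm
    _ ≤ ∫ _, (b + c) ∂iidLaw μ :=
        integral_mono (integrable_stoppedValue ℕ h_stop (integrable_walk h_int)
          fun ω => min_le_right _ _) (integrable_const _) h_le
    _ = b + c := by simp

theorem lintegral_le_of_walk_le (hZm : Measurable Z) (hZ : Integrable Z μ)
    (hτ : IsStoppingTime (obsFiltration E) τ) {b c : ℝ} (hb : 0 ≤ b) (hc : 0 ≤ c)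
    (h_pos : 0 < ∫ x, min (Z x) c ∂μ) (h : ∀ ω, ∀ k : ℕ, k < τ ω → walk Z k ω ≤ b) :
    ∫⁻ ω, (τ ω : ℝ≥0∞) ∂iidLaw μ ≤ ENNReal.ofReal ((b + c) / ∫ x, min (Z x) c ∂μ) := by
  have h_meas (N : ℕ) : Measurable fun ω => ((min (τ ω) N : ℕ∞) : ℝ≥0∞) := by
    have := measurable_of_isStoppingTime hτ
    fun_prop
  have h_mono : Monotone fun (N : ℕ) ω => ((min (τ ω) N : ℕ∞) : ℝ≥0∞) := fun M N hMN ω =>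
    ENat.toENNReal_mono (min_le_min_left _ (Nat.cast_le.2 hMN))
  have h_bdd (N : ℕ) : ∫⁻ ω, (min (τ ω) N : ℕ∞) ∂iidLaw μ ≠ ⊤ :=
    ne_top_of_le_ne_top (by simp) <|
      lintegral_mono (g := fun _ => (N : ℝ≥0∞)) fun ω => by simp
  calc ∫⁻ ω, (τ ω : ℝ≥0∞) ∂iidLaw μ
      = ⨆ N : ℕ, ∫⁻ ω, (min (τ ω) N : ℕ∞) ∂iidLaw μ := by
        rw [← lintegral_iSup h_meas h_mono]
        exact lintegral_congr fun ω => (iSup_min_natCast _).symm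
    _ ≤ ENNReal.ofReal ((b + c) / ∫ x, min (Z x) c ∂μ) := by
        refine iSup_le fun N => (ENNReal.le_ofReal_iff_toReal_le (h_bdd N) (by positivity)).2 ?_
        exact (le_div_iff₀ h_pos).2 (lintegral_min_mul_integral_min_le hZm hZ hτ hb hc h N)

/-- Truncating the steps from above bounds the overshoot over `b`, at the price of a slightly
smaller drift. -/
theorem exists_lintegral_le_of_walk_le (hZm : Measurable Z) (hZ : Integrable Z μ)
    (hI : 0 < ∫ x, Z x ∂μ) {r : ℝ} (hr : 1 < r) :
    ∃ C : ℝ, ∀ b : ℝ, 0 ≤ b → ∀ τ : (ℕ → E) → ℕ∞, IsStoppingTime (obsFiltration E) τ →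
      (∀ ω, ∀ k : ℕ, k < τ ω → walk Z k ω ≤ b) →
      ∫⁻ ω, (τ ω : ℝ≥0∞) ∂iidLaw μ ≤ ENNReal.ofReal (r * (b / ∫ x, Z x ∂μ) + C) := by
  obtain ⟨c, hc⟩ := ((tendsto_integral_min_natCast hZ).eventually_const_lt
    (div_lt_self hI hr)).exists
  have h_pos : 0 < (∫ x, Z x ∂μ) / r := by positivity
  refine ⟨r * (c / ∫ x, Z x ∂μ), fun b hb τ hτ h => ?_⟩
  refine (lintegral_le_of_walk_le hZm hZ hτ hb c.cast_nonneg (h_pos.trans hc) h).trans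
    (ENNReal.ofReal_le_ofReal ?_)
  calc (b + c) / ∫ x, min (Z x) c ∂μ ≤ (b + c) / ((∫ x, Z x ∂μ) / r) := by gcongr
    _ = r * (b / ∫ x, Z x ∂μ) + r * (c / ∫ x, Z x ∂μ) := by field_simp

end ExitTime

section SPRT

variable {E : Type*} {Z : E → ℝ}

/-- The first time `n ≥ 1` at which the walk with steps `Z` is outside `(-a, b)`. -/
noncomputable def exitTime (Z : E → ℝ) (a b : ℝ) : (ℕ → E) → ℕ∞ :=
  hittingAfter (walk Z) (Set.Ioo (-a) b)ᶜ 1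

theorem one_le_exitTime (a b : ℝ) (ω : ℕ → E) : 1 ≤ exitTime Z a b ω :=
  le_hittingAfter ω

theorem walk_mem_Icc_of_lt_exitTime {a b : ℝ} (ha : 0 ≤ a) (hb : 0 ≤ b) {ω : ℕ → E} {k : ℕ}
    (h : k < exitTime Z a b ω) : walk Z k ω ∈ Set.Icc (-a) b := by
  rcases Nat.eq_zero_or_pos k with rfl | hk
  · simp [walk, ha, hb]
  · exact Set.Ioo_subset_Icc_self (Set.notMem_compl_iff.1 (notMem_of_lt_hittingAfter h hk))

theorem stoppedValue_exitTime_notMem {a b : ℝ} {ω : ℕ → E} (h : exitTime Z a b ω ≠ ⊤) :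
    stoppedValue (walk Z) (exitTime Z a b) ω ∉ Set.Ioo (-a) b :=
  hittingAfter_mem_set_of_ne_top h

variable [MeasurableSpace E]

open Classical in
/-- The sequential test that stops at the stopping time `τ` and decides for the alternative on the
event `A` of the past of `τ`. -/
noncomputable def SeqTest.ofIsStoppingTime {τ : (ℕ → E) → ℕ∞}
    (hτ : IsStoppingTime (obsFiltration E) τ) (hτ_one : ∀ ω, 1 ≤ τ ω) {A : Set (ℕ → E)}
    (hA : MeasurableSet[hτ.measurableSpace] A) : SeqTest E where
  T := τ
  D ω := decide (ω ∈ A)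
  one_le_T := hτ_one
  measurable_D := measurable_to_bool <| by
    simpa [Set.preimage] using hτ.measurableSpace_le _ hA
  measurableSet_T n _ := hτ.measurableSet_eq n
  measurableSet_T_D n _ i := by
    have h_inter {B : Set (ℕ → E)} (hB : MeasurableSet[hτ.measurableSpace] B) :
        MeasurableSet[obsSigma E n] ({ω | τ ω = n} ∩ B) :=
      Set.inter_comm B _ ▸ (hτ.measurableSet_inter_eq_iff B n).1
        (MeasurableSet.inter hB (hτ.measurableSet_eq' n))
    cases i
    · simpa only [decide_eq_false_iff_not] using! h_inter hA.compl
    · simpa only [decide_eq_true_eq] using! h_inter hA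

theorem isStoppingTime_exitTime (hZ : Measurable Z) (a b : ℝ) :
    IsStoppingTime (obsFiltration E) (exitTime Z a b) :=
  (stronglyAdapted_walk hZ).adapted.isStoppingTime_hittingAfter measurableSet_Ioo.compl

theorem measurable_stoppedValue_walk (hZ : Measurable Z) {τ : (ℕ → E) → ℕ∞}
    (hτ : IsStoppingTime (obsFiltration E) τ) :
    Measurable[hτ.measurableSpace] (stoppedValue (walk Z) τ) :=
  measurable_stoppedValue (stronglyAdapted_walk hZ).isStronglyProgressive_of_discrete hτ

/-- The sequential probability ratio test: it stops as soon as the walk with steps `Z` leaves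
`(-a, b)`, and decides for the alternative if the walk exits at the lower boundary. -/
noncomputable def sprt (hZ : Measurable Z) (a b : ℝ) : SeqTest E :=
  SeqTest.ofIsStoppingTime (isStoppingTime_exitTime hZ a b) (one_le_exitTime a b)
    (measurable_stoppedValue_walk hZ (isStoppingTime_exitTime hZ a b) (measurableSet_Iic (a := -a)))

variable {μ₀ μ₁ : Measure E} [IsProbabilityMeasure μ₀] [IsProbabilityMeasure μ₁]

theorem exists_ess_sprt_le (hZm : Measurable Z) (hZ₀ : Integrable Z μ₀)
    (hZ₁ : Integrable (-Z) μ₁) (hI₀ : 0 < ∫ x, Z x ∂μ₀) (hI₁ : 0 < ∫ x, (-Z) x ∂μ₁) {r : ℝ}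
    (hr : 1 < r) :
    ∃ C : ℝ, ∀ a b : ℝ, 0 ≤ a → 0 ≤ b →
      (sprt hZm a b).ess (iidLaw μ₀) ≤ ENNReal.ofReal (r * (b / ∫ x, Z x ∂μ₀) + C) ∧
      (sprt hZm a b).ess (iidLaw μ₁) ≤ ENNReal.ofReal (r * (a / ∫ x, (-Z) x ∂μ₁) + C) := by
  obtain ⟨C₀, hC₀⟩ := exists_lintegral_le_of_walk_le hZm hZ₀ hI₀ hr
  obtain ⟨C₁, hC₁⟩ := exists_lintegral_le_of_walk_le hZm.neg hZ₁ hI₁ hr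
  refine ⟨max C₀ C₁, fun a b ha hb => ⟨?_, ?_⟩⟩
  · refine (hC₀ b hb _ (isStoppingTime_exitTime hZm a b) fun ω k hk =>
      (walk_mem_Icc_of_lt_exitTime ha hb hk).2).trans (ENNReal.ofReal_le_ofReal ?_)
    gcongr
    exact le_max_left _ _
  · refine (hC₁ a ha _ (isStoppingTime_exitTime hZm a b) fun ω k hk => ?_).trans
      (ENNReal.ofReal_le_ofReal ?_)
    · rw [walk_neg]
      exact neg_le.1 (walk_mem_Icc_of_lt_exitTime ha hb hk).1
    · gcongr
      exact le_max_right _ _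

theorem SeqTest.measure_le_of_inter_ne_top_le {χ : SeqTest E} {P : Measure (ℕ → E)}
    (h_ess : χ.ess P ≠ ⊤) {B : Set (ℕ → E)} {x : ℝ≥0∞} (h : P (B ∩ {ω | χ.T ω ≠ ⊤}) ≤ x) :
    P B ≤ x :=
  (measure_inter_conull (ae_T_ne_top h_ess)).symm.trans_le h

theorem sprt_mem_testClass (h : IsLLR Z μ₀ μ₁) {a b : ℝ}
    (h_ess₀ : (sprt h.measurable a b).ess (iidLaw μ₀) ≠ ⊤)
    (h_ess₁ : (sprt h.measurable a b).ess (iidLaw μ₁) ≠ ⊤) :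
    sprt h.measurable a b ∈ testClass μ₀ μ₁ (Real.exp (-a)) (Real.exp (-b)) := by
  have hτ := isStoppingTime_exitTime h.measurable a b
  have h_meas : MeasurableSet[hτ.measurableSpace]
      {ω | stoppedValue (walk Z) (exitTime Z a b) ω ≤ -a} :=
    measurable_stoppedValue_walk h.measurable hτ measurableSet_Iic
  constructor
  · have h_set : {ω | (sprt h.measurable a b).D ω = true} =
        {ω | stoppedValue (walk Z) (exitTime Z a b) ω ≤ -a} := by
      ext ω
      simp [sprt, SeqTest.ofIsStoppingTime]
    rw [h_set]
    refine SeqTest.measure_le_of_inter_ne_top_le h_ess₀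
      (iidLaw_inter_ne_top_le_exp_neg h.symm hτ h_meas fun ω hω _ => ?_)
    exact (le_neg.2 hω).trans_eq (walk_neg Z _ ω).symm
  · have h_set : {ω | (sprt h.measurable a b).D ω = false} =
        {ω | stoppedValue (walk Z) (exitTime Z a b) ω ≤ -a}ᶜ := by
      ext ω
      simp [sprt, SeqTest.ofIsStoppingTime]
    rw [h_set]
    refine SeqTest.measure_le_of_inter_ne_top_le h_ess₁
      (iidLaw_inter_ne_top_le_exp_neg h hτ h_meas.compl fun ω hω h_top => ?_)
    by_contra! h_lt
    exact stoppedValue_exitTime_notMem h_top ⟨not_le.1 hω, h_lt⟩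

end SPRT

section BinomialLevel

variable {n k : ℕ} {p α : ℝ}

theorem sum_choose_mul_pow_mul_pow (n : ℕ) (p : ℝ) :
    ∑ j ∈ Finset.range (n + 1), (n.choose j : ℝ) * p ^ j * (1 - p) ^ (n - j) = 1 := by
  simpa [Polynomial.eval_finsetSum, bernsteinPolynomial] using
    congrArg (Polynomial.eval p) (bernsteinPolynomial.sum ℝ n)

theorem sum_mul_choose_mul_pow_mul_pow (n : ℕ) (p : ℝ) :
    ∑ j ∈ Finset.range (n + 1), (j : ℝ) * ((n.choose j : ℝ) * p ^ j * (1 - p) ^ (n - j)) =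
      n * p := by
  simpa [Polynomial.eval_finsetSum, bernsteinPolynomial] using
    congrArg (Polynomial.eval p) (bernsteinPolynomial.sum_smul ℝ n)

theorem sum_sq_sub_mul_choose_mul_pow_mul_pow (n : ℕ) (p : ℝ) :
    ∑ j ∈ Finset.range (n + 1),
      (n * p - j) ^ 2 * ((n.choose j : ℝ) * p ^ j * (1 - p) ^ (n - j)) = n * p * (1 - p) := by
  simpa [Polynomial.eval_finsetSum, bernsteinPolynomial] using
    congrArg (Polynomial.eval p) (bernsteinPolynomial.variance ℝ n)

theorem choose_mul_pow_mul_pow_nonneg (n j : ℕ) (hp : p ∈ Set.Icc 0 1) :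
    0 ≤ (n.choose j : ℝ) * p ^ j * (1 - p) ^ (n - j) := by
  have := hp.1
  have := sub_nonneg.2 hp.2
  positivity

theorem mul_binomTail_le (hp : p ∈ Set.Icc 0 1) : k * binomTail n p k ≤ n * p := by
  rw [← sum_mul_choose_mul_pow_mul_pow n p, binomTail, Finset.mul_sum]
  have h_nonneg := fun j => choose_mul_pow_mul_pow_nonneg n j hp
  calc ∑ j ∈ Finset.Icc k n, (k : ℝ) * ((n.choose j : ℝ) * p ^ j * (1 - p) ^ (n - j))
    _ ≤ ∑ j ∈ Finset.Icc k n, (j : ℝ) * ((n.choose j : ℝ) * p ^ j * (1 - p) ^ (n - j)) := by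
      refine Finset.sum_le_sum fun j hj => mul_le_mul_of_nonneg_right ?_ (h_nonneg j)
      exact_mod_cast (Finset.mem_Icc.1 hj).1
    _ ≤ _ := Finset.sum_le_sum_of_subset_of_nonneg
      (fun j hj => Finset.mem_range_succ_iff.2 (Finset.mem_Icc.1 hj).2)
      fun j _ _ => mul_nonneg j.cast_nonneg (h_nonneg j)

theorem one_sub_binomTail (hkn : k ≤ n) :
    1 - binomTail n p k =
      ∑ j ∈ Finset.range k, (n.choose j : ℝ) * p ^ j * (1 - p) ^ (n - j) := by
  rw [sub_eq_iff_eq_add, binomTail, ← Finset.Ico_add_one_right_eq_Icc,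
    Finset.sum_range_add_sum_Ico _ (by lia), sum_choose_mul_pow_mul_pow]

theorem sq_sub_mul_one_sub_binomTail_le (hp : p ∈ Set.Icc 0 1) (hkn : k ≤ n)
    (hk : (k : ℝ) ≤ n * p) : (n * p - k) ^ 2 * (1 - binomTail n p k) ≤ n * p := by
  rw [one_sub_binomTail hkn, Finset.mul_sum]
  have h_nonneg := fun j => choose_mul_pow_mul_pow_nonneg n j hp
  calc ∑ j ∈ Finset.range k, (n * p - k) ^ 2 * ((n.choose j : ℝ) * p ^ j * (1 - p) ^ (n - j))
    _ ≤ ∑ j ∈ Finset.range k,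
        (n * p - j) ^ 2 * ((n.choose j : ℝ) * p ^ j * (1 - p) ^ (n - j)) := by
      refine Finset.sum_le_sum fun j hj => mul_le_mul_of_nonneg_right ?_ (h_nonneg j)
      have : (j : ℝ) ≤ k := by exact_mod_cast (Finset.mem_range.1 hj).le
      exact pow_le_pow_left₀ (by linarith) (by linarith) 2
    _ ≤ n * p * (1 - p) := by
      rw [← sum_sq_sub_mul_choose_mul_pow_mul_pow]
      exact Finset.sum_le_sum_of_subset_of_nonneg (Finset.range_mono (by lia))
        fun j _ _ => mul_nonneg (sq_nonneg _) (h_nonneg j)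
    _ ≤ n * p :=
      mul_le_of_le_one_right (mul_nonneg n.cast_nonneg hp.1) (by linarith [hp.1])

theorem mul_div_le_binomLevel (hk : 1 ≤ k) (hkn : k ≤ n) (hα : α ∈ Set.Ioo 0 1) :
    α * (k / n) ≤ binomLevel n k α := by
  have hk_pos : (0 : ℝ) < k := by exact_mod_cast hk
  have hn_pos : (0 : ℝ) < n := by exact_mod_cast hk.trans hkn
  have hkn' : (k : ℝ) / n ≤ 1 := (div_le_one hn_pos).2 (by exact_mod_cast hkn)
  have hp : α * (k / n) ∈ Set.Ioo (0 : ℝ) 1 :=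
    ⟨mul_pos hα.1 (by positivity), (mul_le_of_le_one_right hα.1.le hkn').trans_lt hα.2⟩
  refine (isGreatest_binomLevel n k α hk hkn hα).2 ⟨hp, le_of_mul_le_mul_left ?_ hk_pos⟩
  calc k * binomTail n (α * (k / n)) k ≤ n * (α * (k / n)) := mul_binomTail_le ⟨hp.1.le, hp.2.le⟩
    _ = k * α := by field_simp

theorem binomLevel_le_mul_div (hk : 1 ≤ k) (hkn : k ≤ n) (hα : α ∈ Set.Ioo 0 1) :
    binomLevel n k α ≤ (2 + 1 / (1 - α)) * (k / n) := by
  obtain ⟨⟨hp₀, hp₁⟩, hp⟩ := (isGreatest_binomLevel n k α hk hkn hα).1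
  set p := binomLevel n k α
  have hk_one : (1 : ℝ) ≤ k := by exact_mod_cast hk
  have hn_pos : (0 : ℝ) < n := by exact_mod_cast hk.trans hkn
  have hα' : 0 < 1 - α := sub_pos.2 hα.2
  rw [← mul_div_assoc, le_div_iff₀' hn_pos]
  by_contra! h_lt
  have h_gap : 1 / (1 - α) < n * p - 2 * k := by
    have : 1 / (1 - α) ≤ 1 / (1 - α) * k := le_mul_of_one_le_right (by positivity) hk_one
    linarith
  have h_gap_pos : 0 < n * p - 2 * k := h_gap.trans' (by positivity)
  have hnp : 0 < n * p := mul_pos hn_pos hp₀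
  rw [div_lt_iff₀ hα'] at h_gap
  have h_chebyshev := sq_sub_mul_one_sub_binomTail_le ⟨hp₀.le, hp₁.le⟩ hkn (by linarith)
  refine h_chebyshev.not_gt ?_
  calc n * p < n * p * ((n * p - 2 * k) * (1 - α)) := lt_mul_of_one_lt_right hnp h_gap
    _ = (n * p * (n * p - 2 * k)) * (1 - α) := by ring
    _ ≤ (n * p - k) ^ 2 * (1 - binomTail n p k) := by
      gcongr
      nlinarith

end BinomialLevel

section BinomialLevelAsymptotics

variable {X : Type*} {F : Filter X} {n k : X → ℕ} {α : ℝ}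

theorem tendsto_natCast_div_natCast_atTop (hk : ∀ᶠ x in F, 1 ≤ k x ∧ k x ≤ n x)
    (hkn : Tendsto (fun x => (k x : ℝ) / n x) F (𝓝 0)) :
    Tendsto (fun x => (n x : ℝ) / k x) F atTop := by
  have h_pos : ∀ᶠ x in F, (0 : ℝ) < k x / n x := hk.mono fun x hx =>
    div_pos (by exact_mod_cast hx.1) (by exact_mod_cast hx.1.trans hx.2)
  simpa only [Pi.inv_def, inv_div] using
    (tendsto_nhdsWithin_iff.2 ⟨hkn, h_pos⟩).inv_tendsto_nhdsGT_zero

theorem tendsto_log_natCast_div_natCast_atTop (hk : ∀ᶠ x in F, 1 ≤ k x ∧ k x ≤ n x)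
    (hkn : Tendsto (fun x => (k x : ℝ) / n x) F (𝓝 0)) :
    Tendsto (fun x => Real.log (n x / k x)) F atTop :=
  Real.tendsto_log_atTop.comp (tendsto_natCast_div_natCast_atTop hk hkn)

theorem tendsto_binomLevel_nhdsGT_zero (hα : α ∈ Set.Ioo 0 1)
    (hk : ∀ᶠ x in F, 1 ≤ k x ∧ k x ≤ n x)
    (hkn : Tendsto (fun x => (k x : ℝ) / n x) F (𝓝 0)) :
    Tendsto (fun x => binomLevel (n x) (k x) α) F (𝓝[>] 0) := by
  have h_pos : ∀ᶠ x in F, 0 < binomLevel (n x) (k x) α :=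
    hk.mono fun x hx => (isGreatest_binomLevel _ _ α hx.1 hx.2 hα).1.1.1
  refine tendsto_nhdsWithin_iff.2 ⟨squeeze_zero' (h_pos.mono fun x hx => hx.le)
    (hk.mono fun x hx => binomLevel_le_mul_div hx.1 hx.2 hα) ?_, h_pos⟩
  simpa using hkn.const_mul (2 + 1 / (1 - α))

theorem abs_log_sub_log_le_of_mul_le_of_le_mul {a b x y : ℝ} (ha : 0 < a) (hb : 0 < b)
    (hy : 0 < y) (h_lower : a * y ≤ x) (h_upper : x ≤ b * y) :
    |Real.log x - Real.log y| ≤ max (-Real.log a) (Real.log b) := by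
  have h₁ := Real.log_le_log (mul_pos ha hy) h_lower
  have h₂ := Real.log_le_log ((mul_pos ha hy).trans_le h_lower) h_upper
  rw [Real.log_mul ha.ne' hy.ne'] at h₁
  rw [Real.log_mul hb.ne' hy.ne'] at h₂
  rw [abs_le]
  constructor
  · linarith [le_max_left (-Real.log a) (Real.log b)]
  · linarith [le_max_right (-Real.log a) (Real.log b)]

theorem isEquivalent_log_one_div_binomLevel (hα : α ∈ Set.Ioo 0 1)
    (hk : ∀ᶠ x in F, 1 ≤ k x ∧ k x ≤ n x)
    (hkn : Tendsto (fun x => (k x : ℝ) / n x) F (𝓝 0)) :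
    Asymptotics.IsEquivalent F (fun x => Real.log (1 / binomLevel (n x) (k x) α))
      (fun x => Real.log (n x / k x)) := by
  have hC : 0 < 2 + 1 / (1 - α) := by
    have := sub_pos.2 hα.2
    positivity
  refine Asymptotics.IsBigO.trans_isLittleO (g := fun _ => (1 : ℝ)) ?_ <|
    (Asymptotics.isLittleO_one_left_iff ℝ).2 <|
      tendsto_norm_atTop_atTop.comp (tendsto_log_natCast_div_natCast_atTop hk hkn)
  refine Asymptotics.IsBigO.of_bound (max (-Real.log α) (Real.log (2 + 1 / (1 - α)))) ?_
  filter_upwards [hk] with x hx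
  have hr : (0 : ℝ) < k x / n x :=
    div_pos (by exact_mod_cast hx.1) (by exact_mod_cast hx.1.trans hx.2)
  have h_log := abs_log_sub_log_le_of_mul_le_of_le_mul hα.1 hC hr
    (mul_div_le_binomLevel hx.1 hx.2 hα) (binomLevel_le_mul_div hx.1 hx.2 hα)
  have h_inv : Real.log (n x / k x) = -Real.log (k x / n x) := by rw [← Real.log_inv, inv_div]
  rw [Pi.sub_apply, one_div, Real.log_inv, h_inv, ← neg_sub', norm_neg, norm_one, mul_one]
  exact h_log

end BinomialLevelAsymptotics

section AsympLE

variable {X Y : Type*} {F : Filter X}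

/-- `f` is asymptotically at most `g` along the filter `F`, that is `limsup f / g ≤ 1`; the
division is avoided because `f` and `g` may take the values `0` and `∞`. -/
def AsympLE (F : Filter X) (f g : X → ℝ≥0∞) : Prop :=
  ∀ c : ℝ, 1 < c → ∀ᶠ x in F, f x ≤ ENNReal.ofReal c * g x

variable {f f' g g' h : X → ℝ≥0∞}

theorem AsympLE.of_eventually_le (hfg : ∀ᶠ x in F, f x ≤ g x) : AsympLE F f g := fun _ hc =>
  hfg.mono fun _ hx => hx.trans <|
    le_mul_of_one_le_left zero_le (ENNReal.one_le_ofReal.2 hc.le)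

theorem AsympLE.trans (hfg : AsympLE F f g) (hgh : AsympLE F g h) : AsympLE F f h := by
  intro c hc
  have h_sqrt : 1 < √c := Real.lt_sqrt_of_sq_lt (by simpa using hc)
  filter_upwards [hfg _ h_sqrt, hgh _ h_sqrt] with x hfx hgx
  calc f x ≤ ENNReal.ofReal √c * (ENNReal.ofReal √c * h x) := hfx.trans (by gcongr)
    _ = ENNReal.ofReal c * h x := by
      rw [← mul_assoc, ← ENNReal.ofReal_mul (by positivity), Real.mul_self_sqrt (by linarith)]

theorem AsympLE.const_mul (hfg : AsympLE F f g) (w : X → ℝ≥0∞) :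
    AsympLE F (fun x => w x * f x) (fun x => w x * g x) := fun c hc =>
  (hfg c hc).mono fun x hx => (mul_le_mul_right hx (w x)).trans_eq (mul_left_comm _ _ _)

theorem AsympLE.add (hfg : AsympLE F f g) (hfg' : AsympLE F f' g') :
    AsympLE F (fun x => f x + f' x) (fun x => g x + g' x) := fun c hc => by
  filter_upwards [hfg c hc, hfg' c hc] with x hx hx'
  rw [mul_add]
  gcongr

theorem AsympLE.add_of_forall_eventually_le_mul (hfg : AsympLE F f g) (hhg : AsympLE F h g)
    (hf' : ∀ ε : ℝ, 0 < ε → ∀ᶠ x in F, f' x ≤ ENNReal.ofReal ε * h x) :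
    AsympLE F (fun x => f x + f' x) g := fun c hc => by
  filter_upwards [hfg ((1 + c) / 2) (by linarith), hhg 2 one_lt_two,
    hf' ((c - 1) / 4) (by linarith)] with x hfx hhx hfx'
  calc f x + f' x
    _ ≤ ENNReal.ofReal ((1 + c) / 2) * g x +
        ENNReal.ofReal ((c - 1) / 4) * (ENNReal.ofReal 2 * g x) := by
      gcongr
      exact hfx'.trans (by gcongr)
    _ = ENNReal.ofReal c * g x := by
      rw [← mul_assoc, ← ENNReal.ofReal_mul (by linarith), ← add_mul,
        ← ENNReal.ofReal_add (by linarith) (by linarith)]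
      ring_nf

theorem AsympLE.comp_tendsto {G : Filter Y} {φ : Y → X} (hfg : AsympLE F f g)
    (hφ : Tendsto φ G F) : AsympLE G (f ∘ φ) (g ∘ φ) := fun c hc =>
  hφ.eventually (hfg c hc)

theorem AsympLE.eventually_ne_top (hfg : AsympLE F f g) (hg : ∀ᶠ x in F, g x ≠ ⊤) :
    ∀ᶠ x in F, f x ≠ ⊤ := by
  filter_upwards [hfg 2 one_lt_two, hg] with x hx hgx
  exact ne_top_of_le_ne_top (ENNReal.mul_ne_top ENNReal.ofReal_ne_top hgx) hx

theorem AsympLE.eventually_ne_zero (hfg : AsympLE F f g) (hf : ∀ᶠ x in F, f x ≠ 0) :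
    ∀ᶠ x in F, g x ≠ 0 := by
  filter_upwards [hfg 2 one_lt_two, hf] with x hx hfx hgx
  exact hfx (by simpa [hgx] using hx)

theorem eventually_le_ofReal_mul_of_tendsto_div {a : ℝ≥0∞}
    (hfg : Tendsto (fun x => f x / g x) F (𝓝 a)) {c : ℝ} (hc : a < ENNReal.ofReal c) :
    ∀ᶠ x in F, f x ≤ ENNReal.ofReal c * g x := by
  filter_upwards [hfg.eventually_lt_const hc] with x hx
  exact (ENNReal.div_le_iff_le_mul (Or.inr ENNReal.ofReal_ne_top) (Or.inr hc.ne_bot)).1 hx.le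

theorem AsympLE.of_tendsto_div (hfg : Tendsto (fun x => f x / g x) F (𝓝 1)) : AsympLE F f g :=
  fun _ hc => eventually_le_ofReal_mul_of_tendsto_div hfg (ENNReal.one_lt_ofReal.2 hc)

theorem AsympLE.of_isEquivalent {a b : X → ℝ} (hab : Asymptotics.IsEquivalent F a b)
    (hb : ∀ᶠ x in F, 0 ≤ b x) :
    AsympLE F (fun x => ENNReal.ofReal (a x)) (fun x => ENNReal.ofReal (b x)) := fun c hc => by
  filter_upwards [hab.isLittleO.bound (sub_pos.2 hc), hb] with x hx hbx
  rw [← ENNReal.ofReal_mul' hbx]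
  refine ENNReal.ofReal_le_ofReal ?_
  rw [Pi.sub_apply, Real.norm_of_nonneg hbx] at hx
  linarith [(Real.le_norm_self _).trans hx]

end AsympLE

section UniformFilter

variable {l u : ℕ → ℕ}

/-- The filter on the pairs `(m, s)` that encodes `m → ∞` uniformly in `s ∈ {l m, …, u m}`. -/
def uniformFilter (l u : ℕ → ℕ) : Filter (ℕ × ℕ) :=
  comap Prod.fst atTop ⊓ 𝓟 {p | l p.1 ≤ p.2 ∧ p.2 ≤ u p.1}

theorem eventually_uniformFilter_iff {P : ℕ × ℕ → Prop} :
    (∀ᶠ p in uniformFilter l u, P p) ↔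
      ∀ᶠ m in atTop, ∀ s, l m ≤ s → s ≤ u m → P (m, s) := by
  simp only [uniformFilter, eventually_inf_principal, eventually_comap, Prod.forall]
  refine eventually_congr (Eventually.of_forall fun m => ⟨fun h s hl hu => h m s rfl ⟨hl, hu⟩, ?_⟩)
  rintro h m s rfl ⟨hl, hu⟩
  exact h s hl hu

theorem tendsto_fst_uniformFilter (l u : ℕ → ℕ) :
    Tendsto Prod.fst (uniformFilter l u) atTop :=
  tendsto_comap.mono_left inf_le_left

theorem unifEquiv_of_asympLE {x y : ℕ × ℕ → ℝ≥0∞} (hxy : AsympLE (uniformFilter l u) x y)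
    (hyx : AsympLE (uniformFilter l u) y x) (hy₀ : ∀ᶠ p in uniformFilter l u, y p ≠ 0)
    (hy_top : ∀ᶠ p in uniformFilter l u, y p ≠ ⊤) :
    UnifEquiv l u (fun m s => x (m, s)) (fun m s => y (m, s)) := by
  intro ε hε
  refine (eventually_uniformFilter_iff (P := fun p =>
    ENNReal.ofReal (1 - ε) ≤ x p / y p ∧ x p / y p ≤ ENNReal.ofReal (1 + ε))).1 ?_
  filter_upwards [hxy (1 + ε) (by linarith), hyx (1 + ε) (by linarith), hy₀, hy_top]
    with p hxy hyx hy₀ hy_top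
  rw [ENNReal.le_div_iff_mul_le (Or.inl hy₀) (Or.inl hy_top),
    ENNReal.div_le_iff_le_mul (Or.inl hy₀) (Or.inl hy_top)]
  refine ⟨?_, hxy⟩
  calc ENNReal.ofReal (1 - ε) * y p ≤ ENNReal.ofReal (1 - ε) * (ENNReal.ofReal (1 + ε) * x p) := by
        gcongr
    _ = ENNReal.ofReal ((1 - ε) * (1 + ε)) * x p := by
      rw [← mul_assoc, ENNReal.ofReal_mul' (by linarith)]
    _ ≤ x p := mul_le_of_le_one_left zero_le (ENNReal.ofReal_le_one.2 (by nlinarith))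

end UniformFilter

section FirstOrderAsymptotics

variable {X : Type*} {F : Filter X}

theorem isEquivalent_one_sub_mul_sub_one {a b : X → ℝ} (ha : Tendsto a F (𝓝 0))
    (hb : Tendsto b F atTop) :
    Asymptotics.IsEquivalent F (fun x => (1 - a x) * b x - 1) b := by
  have h_one : (fun _ => (1 : ℝ)) =o[F] b :=
    (Asymptotics.isLittleO_one_left_iff ℝ).2 (tendsto_norm_atTop_atTop.comp hb)
  have h_mul : (fun x => a x * b x) =o[F] b := by
    simpa using ((Asymptotics.isLittleO_one_iff ℝ).2 ha).mul_isBigO (Asymptotics.isBigO_refl b F)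
  refine ((h_mul.add h_one).neg_left).congr_left fun x => ?_
  simp only [Pi.sub_apply]
  ring

theorem asympLE_ofReal_of_forall_le_mul_add {f : X → ℝ≥0∞} {b : X → ℝ} (hb : Tendsto b F atTop)
    (hf : ∀ r : ℝ, 1 < r → ∃ C : ℝ, ∀ᶠ x in F, f x ≤ ENNReal.ofReal (r * b x + C)) :
    AsympLE F f (fun x => ENNReal.ofReal (b x)) := by
  intro c hc
  obtain ⟨C, hC⟩ := hf ((1 + c) / 2) (by linarith)
  filter_upwards [hC, hb.eventually_ge_atTop 0, hb.eventually_ge_atTop (C / ((c - 1) / 2))]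
    with x hx hbx₀ hbx
  rw [← ENNReal.ofReal_mul' hbx₀]
  refine hx.trans (ENNReal.ofReal_le_ofReal ?_)
  rw [div_le_iff₀ (by linarith)] at hbx
  linarith

variable {E : Type*} [MeasurableSpace E] {μ₀ μ₁ : Measure E} [IsProbabilityMeasure μ₀]
  [IsProbabilityMeasure μ₁] {Z : E → ℝ} {α β : X → ℝ}

theorem tendsto_log_one_div_atTop (hα : Tendsto α F (𝓝[>] 0)) :
    Tendsto (fun x => Real.log (1 / α x)) F atTop := by
  simp only [one_div, Real.log_inv]
  exact tendsto_neg_atBot_atTop.comp (Real.tendsto_log_nhdsGT_zero.comp hα)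

theorem asympLE_lowerBound (hα : Tendsto α F (𝓝[>] 0)) (hβ : Tendsto β F (𝓝[>] 0)) {I : ℝ}
    (hI : 0 < I) :
    AsympLE F (fun x => ENNReal.ofReal (Real.log (1 / β x) / I))
      (fun x => ENNReal.ofReal (((1 - α x) * Real.log (1 / β x) - 1) / I)) := by
  have hb := tendsto_log_one_div_atTop hβ
  have h_equiv := isEquivalent_one_sub_mul_sub_one (tendsto_nhds_of_tendsto_nhdsWithin hα) hb
  have h_atTop := h_equiv.symm.tendsto_atTop hb
  exact .of_isEquivalent (h_equiv.symm.div .refl)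
    ((h_atTop.eventually_ge_atTop 0).mono fun x hx => div_nonneg hx hI.le)

theorem eventually_mem_Ioc_of_tendsto_nhdsGT_zero (hα : Tendsto α F (𝓝[>] 0)) :
    ∀ᶠ x in F, α x ∈ Set.Ioc 0 1 :=
  hα.eventually (Ioc_mem_nhdsGT one_pos)

theorem IsLLR.asympLE_optESS_left (h : IsLLR Z μ₀ μ₁) (hZ : Integrable Z μ₀)
    (hI : 0 < ∫ x, Z x ∂μ₀) (hα : Tendsto α F (𝓝[>] 0)) (hβ : Tendsto β F (𝓝[>] 0)) :
    AsympLE F (fun x => ENNReal.ofReal (Real.log (1 / β x) / ∫ x, Z x ∂μ₀))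
      (fun x => optESS μ₀ μ₁ (iidLaw μ₀) (α x) (β x)) := by
  refine (asympLE_lowerBound hα hβ hI).trans (.of_eventually_le ?_)
  filter_upwards [eventually_mem_Ioc_of_tendsto_nhdsGT_zero hα,
    eventually_mem_Ioc_of_tendsto_nhdsGT_zero hβ] with x hαx hβx
  exact le_iInf₂ fun χ hχ => SeqTest.le_ess (i := false) h hZ hI hαx.1.le hβx hχ.1 hχ.2

theorem IsLLR.asympLE_optESS_right (h : IsLLR Z μ₀ μ₁) (hZ : Integrable (-Z) μ₁)
    (hI : 0 < ∫ x, (-Z) x ∂μ₁) (hα : Tendsto α F (𝓝[>] 0)) (hβ : Tendsto β F (𝓝[>] 0)) :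
    AsympLE F (fun x => ENNReal.ofReal (Real.log (1 / α x) / ∫ x, (-Z) x ∂μ₁))
      (fun x => optESS μ₀ μ₁ (iidLaw μ₁) (α x) (β x)) := by
  refine (asympLE_lowerBound hβ hα hI).trans (.of_eventually_le ?_)
  filter_upwards [eventually_mem_Ioc_of_tendsto_nhdsGT_zero hα,
    eventually_mem_Ioc_of_tendsto_nhdsGT_zero hβ] with x hαx hβx
  exact le_iInf₂ fun χ hχ => SeqTest.le_ess (i := true) h.symm hZ hI hβx.1.le hαx hχ.2 hχ.1

theorem IsLLR.exists_asympLE_ess (h : IsLLR Z μ₀ μ₁) (hZ₀ : Integrable Z μ₀)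
    (hZ₁ : Integrable (-Z) μ₁) (hI₀ : 0 < ∫ x, Z x ∂μ₀) (hI₁ : 0 < ∫ x, (-Z) x ∂μ₁)
    (hα : Tendsto α F (𝓝[>] 0)) (hβ : Tendsto β F (𝓝[>] 0)) :
    ∃ χ : X → SeqTest E, (∀ᶠ x in F, χ x ∈ testClass μ₀ μ₁ (α x) (β x)) ∧
      AsympLE F (fun x => (χ x).ess (iidLaw μ₀))
        (fun x => ENNReal.ofReal (Real.log (1 / β x) / ∫ x, Z x ∂μ₀)) ∧
      AsympLE F (fun x => (χ x).ess (iidLaw μ₁))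
        (fun x => ENNReal.ofReal (Real.log (1 / α x) / ∫ x, (-Z) x ∂μ₁)) := by
  have h_bound (r : ℝ) (hr : 1 < r) : ∃ C : ℝ, ∀ᶠ x in F,
      (sprt h.measurable (Real.log (1 / α x)) (Real.log (1 / β x))).ess (iidLaw μ₀) ≤
        ENNReal.ofReal (r * (Real.log (1 / β x) / ∫ x, Z x ∂μ₀) + C) ∧
      (sprt h.measurable (Real.log (1 / α x)) (Real.log (1 / β x))).ess (iidLaw μ₁) ≤
        ENNReal.ofReal (r * (Real.log (1 / α x) / ∫ x, (-Z) x ∂μ₁) + C) := by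
    obtain ⟨C, hC⟩ := exists_ess_sprt_le h.measurable hZ₀ hZ₁ hI₀ hI₁ hr
    refine ⟨C, ?_⟩
    filter_upwards [(tendsto_log_one_div_atTop hα).eventually_ge_atTop 0,
      (tendsto_log_one_div_atTop hβ).eventually_ge_atTop 0] with x ha hb
    exact hC _ _ ha hb
  refine ⟨fun x => sprt h.measurable (Real.log (1 / α x)) (Real.log (1 / β x)), ?_,
    asympLE_ofReal_of_forall_le_mul_add ((tendsto_log_one_div_atTop hβ).atTop_div_const hI₀)
      fun r hr => (h_bound r hr).imp fun C hC => hC.mono fun x hx => hx.1,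
    asympLE_ofReal_of_forall_le_mul_add ((tendsto_log_one_div_atTop hα).atTop_div_const hI₁)
      fun r hr => (h_bound r hr).imp fun C hC => hC.mono fun x hx => hx.2⟩
  obtain ⟨C, hC⟩ := h_bound 2 one_lt_two
  filter_upwards [hC, eventually_mem_Ioc_of_tendsto_nhdsGT_zero hα,
    eventually_mem_Ioc_of_tendsto_nhdsGT_zero hβ] with x hx hαx hβx
  have h_exp {c : ℝ} (hc : 0 < c) : Real.exp (-Real.log (1 / c)) = c := by
    rw [one_div, Real.log_inv, neg_neg, Real.exp_log hc]
  simpa only [h_exp hαx.1, h_exp hβx.1] using sprt_mem_testClass h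
    (ne_top_of_le_ne_top ENNReal.ofReal_ne_top hx.1)
    (ne_top_of_le_ne_top ENNReal.ofReal_ne_top hx.2)

end FirstOrderAsymptotics

section MixedExpectedSampleSize

variable {X Y E : Type*} [MeasurableSpace E] {μ₀ μ₁ : Measure E} [IsProbabilityMeasure μ₀]
  [IsProbabilityMeasure μ₁]

theorem SeqTest.ess_mixLaw (χ : SeqTest E) (π : ℝ) :
    χ.ess (mixLaw μ₀ μ₁ π) = ENNReal.ofReal (1 - π) * χ.ess (iidLaw μ₀) +
      ENNReal.ofReal π * χ.ess (iidLaw μ₁) := by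
  simp only [SeqTest.ess, mixLaw, lintegral_add_measure, lintegral_smul_measure, smul_eq_mul]

theorem add_le_optESS_mixLaw (α β π : ℝ) :
    ENNReal.ofReal (1 - π) * optESS μ₀ μ₁ (iidLaw μ₀) α β +
        ENNReal.ofReal π * optESS μ₀ μ₁ (iidLaw μ₁) α β ≤
      optESS μ₀ μ₁ (mixLaw μ₀ μ₁ π) α β := by
  refine le_iInf₂ fun χ hχ => ?_
  rw [χ.ess_mixLaw]
  gcongr
  · exact iInf₂_le χ hχ
  · exact iInf₂_le χ hχ

/-- To first order along `F`, the smallest expected sample sizes of the tests in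
`testClass μ₀ μ₁ (α x) (β x)` are `y₀ x` under the first hypothesis and `y₁ x` under the second,
and both are attained by the same family of tests. -/
structure FirstOrderESS (μ₀ μ₁ : Measure E) [IsProbabilityMeasure μ₀] [IsProbabilityMeasure μ₁]
    (F : Filter X) (α β : X → ℝ) (y₀ y₁ : X → ℝ≥0∞) : Prop where
  le_optESS_left : AsympLE F y₀ fun x => optESS μ₀ μ₁ (iidLaw μ₀) (α x) (β x)
  le_optESS_right : AsympLE F y₁ fun x => optESS μ₀ μ₁ (iidLaw μ₁) (α x) (β x)
  exists_ess_le : ∃ χ : X → SeqTest E, (∀ᶠ x in F, χ x ∈ testClass μ₀ μ₁ (α x) (β x)) ∧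
    AsympLE F (fun x => (χ x).ess (iidLaw μ₀)) y₀ ∧ AsympLE F (fun x => (χ x).ess (iidLaw μ₁)) y₁

variable {F : Filter X} {α β : X → ℝ} {y₀ y₁ y₀' y₁' : X → ℝ≥0∞}

theorem FirstOrderESS.comp_tendsto {G : Filter Y} {φ : Y → X}
    (h : FirstOrderESS μ₀ μ₁ F α β y₀ y₁) (hφ : Tendsto φ G F) :
    FirstOrderESS μ₀ μ₁ G (α ∘ φ) (β ∘ φ) (y₀ ∘ φ) (y₁ ∘ φ) := by
  obtain ⟨χ, hχ, hχ₀, hχ₁⟩ := h.exists_ess_le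
  exact ⟨h.le_optESS_left.comp_tendsto hφ, h.le_optESS_right.comp_tendsto hφ,
    χ ∘ φ, hφ.eventually hχ, hχ₀.comp_tendsto hφ, hχ₁.comp_tendsto hφ⟩

theorem FirstOrderESS.congr (h : FirstOrderESS μ₀ μ₁ F α β y₀ y₁) (h₀ : AsympLE F y₀ y₀')
    (h₀' : AsympLE F y₀' y₀) (h₁ : AsympLE F y₁ y₁') (h₁' : AsympLE F y₁' y₁) :
    FirstOrderESS μ₀ μ₁ F α β y₀' y₁' := by
  obtain ⟨χ, hχ, hχ₀, hχ₁⟩ := h.exists_ess_le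
  exact ⟨h₀'.trans h.le_optESS_left, h₁'.trans h.le_optESS_right,
    χ, hχ, hχ₀.trans h₀, hχ₁.trans h₁⟩

theorem IsLLR.firstOrderESS {Z : E → ℝ} (h : IsLLR Z μ₀ μ₁) (hZ₀ : Integrable Z μ₀)
    (hZ₁ : Integrable (-Z) μ₁) (hI₀ : 0 < ∫ x, Z x ∂μ₀) (hI₁ : 0 < ∫ x, (-Z) x ∂μ₁)
    (hα : Tendsto α F (𝓝[>] 0)) (hβ : Tendsto β F (𝓝[>] 0)) :
    FirstOrderESS μ₀ μ₁ F α β (fun x => ENNReal.ofReal (Real.log (1 / β x) / ∫ x, Z x ∂μ₀))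
      (fun x => ENNReal.ofReal (Real.log (1 / α x) / ∫ x, (-Z) x ∂μ₁)) :=
  ⟨h.asympLE_optESS_left hZ₀ hI₀ hα hβ, h.asympLE_optESS_right hZ₁ hI₁ hα hβ,
    h.exists_asympLE_ess hZ₀ hZ₁ hI₀ hI₁ hα hβ⟩

theorem FirstOrderESS.le_optESS_mixLaw (h : FirstOrderESS μ₀ μ₁ F α β y₀ y₁) (π : X → ℝ) :
    AsympLE F (fun x => ENNReal.ofReal (1 - π x) * y₀ x + ENNReal.ofReal (π x) * y₁ x)
      (fun x => optESS μ₀ μ₁ (mixLaw μ₀ μ₁ (π x)) (α x) (β x)) :=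
  ((h.le_optESS_left.const_mul _).add (h.le_optESS_right.const_mul _)).trans <|
    .of_eventually_le <| .of_forall fun x => add_le_optESS_mixLaw (α x) (β x) (π x)

theorem FirstOrderESS.optESS_mixLaw_le (h : FirstOrderESS μ₀ μ₁ F α β y₀ y₁) (π : X → ℝ) :
    AsympLE F (fun x => optESS μ₀ μ₁ (mixLaw μ₀ μ₁ (π x)) (α x) (β x))
      (fun x => ENNReal.ofReal (1 - π x) * y₀ x + ENNReal.ofReal (π x) * y₁ x) := by
  obtain ⟨χ, hχ, hχ₀, hχ₁⟩ := h.exists_ess_le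
  refine .trans (.of_eventually_le <| hχ.mono fun x hx => ?_)
    ((hχ₀.const_mul _).add (hχ₁.const_mul _))
  exact (iInf₂_le (χ x) hx).trans_eq ((χ x).ess_mixLaw (π x))

theorem ofReal_one_sub_mul_add_ofReal_mul_ne_zero {a b : ℝ≥0∞} (ha : a ≠ 0) (hb : b ≠ 0) (π : ℝ) :
    ENNReal.ofReal (1 - π) * a + ENNReal.ofReal π * b ≠ 0 := by
  rw [ne_eq, add_eq_zero, mul_eq_zero_iff_right ha, mul_eq_zero_iff_right hb,
    ENNReal.ofReal_eq_zero, ENNReal.ofReal_eq_zero]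
  rintro ⟨h₀, h₁⟩
  linarith

theorem FirstOrderESS.eventually_optESS_mixLaw_ne (h : FirstOrderESS μ₀ μ₁ F α β y₀ y₁)
    (hy₀ : ∀ᶠ x in F, y₀ x ≠ 0 ∧ y₀ x ≠ ⊤) (hy₁ : ∀ᶠ x in F, y₁ x ≠ 0 ∧ y₁ x ≠ ⊤) (π : X → ℝ) :
    (∀ᶠ x in F, optESS μ₀ μ₁ (mixLaw μ₀ μ₁ (π x)) (α x) (β x) ≠ 0) ∧
      ∀ᶠ x in F, optESS μ₀ μ₁ (mixLaw μ₀ μ₁ (π x)) (α x) (β x) ≠ ⊤ := by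
  refine ⟨(h.le_optESS_mixLaw π).eventually_ne_zero ?_, (h.optESS_mixLaw_le π).eventually_ne_top ?_⟩
  · filter_upwards [hy₀, hy₁] with x h₀ h₁
    exact ofReal_one_sub_mul_add_ofReal_mul_ne_zero h₀.1 h₁.1 (π x)
  · filter_upwards [hy₀, hy₁] with x h₀ h₁
    finiteness [h₀.2, h₁.2]

variable {χ : X → SeqTest E}

theorem asympLE_ess_mixLaw_of_asympLE_optESS
    (hχ₀ : AsympLE F (fun x => (χ x).ess (iidLaw μ₀))
      fun x => optESS μ₀ μ₁ (iidLaw μ₀) (α x) (β x))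
    (hχ₁ : AsympLE F (fun x => (χ x).ess (iidLaw μ₁))
      fun x => optESS μ₀ μ₁ (iidLaw μ₁) (α x) (β x)) (π : X → ℝ) :
    AsympLE F (fun x => (χ x).ess (mixLaw μ₀ μ₁ (π x)))
      (fun x => optESS μ₀ μ₁ (mixLaw μ₀ μ₁ (π x)) (α x) (β x)) := by
  simp only [SeqTest.ess_mixLaw]
  exact ((hχ₀.const_mul _).add (hχ₁.const_mul _)).trans <|
    .of_eventually_le <| .of_forall fun x => add_le_optESS_mixLaw (α x) (β x) (π x)

theorem FirstOrderESS.ess_mixLaw_le_of_negligible (h : FirstOrderESS μ₀ μ₁ F α β y₀ y₁)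
    {π : X → ℝ}
    (hχ₀ : AsympLE F (fun x => (χ x).ess (iidLaw μ₀))
      fun x => optESS μ₀ μ₁ (iidLaw μ₀) (α x) (β x))
    (hχ₁ : ∀ ε : ℝ, 0 < ε → ∀ᶠ x in F, ENNReal.ofReal (π x) * (χ x).ess (iidLaw μ₁) ≤
      ENNReal.ofReal ε * (ENNReal.ofReal (1 - π x) * y₀ x)) :
    AsympLE F (fun x => (χ x).ess (mixLaw μ₀ μ₁ (π x)))
      (fun x => optESS μ₀ μ₁ (mixLaw μ₀ μ₁ (π x)) (α x) (β x)) := by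
  simp only [SeqTest.ess_mixLaw]
  exact ((hχ₀.const_mul _).add_of_forall_eventually_le_mul
    (h.le_optESS_left.const_mul _) hχ₁).trans <|
    .of_eventually_le <| .of_forall fun x => le_self_add.trans (add_le_optESS_mixLaw _ _ (π x))

end MixedExpectedSampleSize

section UniformAsymptotics

variable {E : Type*} [MeasurableSpace E] {μ₀ μ₁ : Measure E} [IsProbabilityMeasure μ₀]
  [IsProbabilityMeasure μ₁] {l u : ℕ → ℕ} {α β : ℕ → ℝ} {y₀ y₁ : ℕ → ℝ} {χ : ℕ → SeqTest E}

theorem div_mem_Icc_of_le {s m : ℕ} (h : s ≤ m) : (s : ℝ) / m ∈ Set.Icc 0 1 :=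
  ⟨by positivity, div_le_one_of_le₀ (by exact_mod_cast h) m.cast_nonneg⟩

theorem ofReal_one_sub_mul_add_mul {π a b : ℝ} (hπ : π ∈ Set.Icc 0 1) (ha : 0 ≤ a) (hb : 0 ≤ b) :
    ENNReal.ofReal ((1 - π) * a + π * b) =
      ENNReal.ofReal (1 - π) * ENNReal.ofReal a + ENNReal.ofReal π * ENNReal.ofReal b := by
  have hπ' := sub_nonneg.2 hπ.2
  rw [ENNReal.ofReal_add (mul_nonneg hπ' ha) (mul_nonneg hπ.1 hb), ENNReal.ofReal_mul hπ',
    ENNReal.ofReal_mul hπ.1]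

theorem eventually_ofReal_ne_zero_and_ne_top {X : Type*} {F : Filter X} {y : X → ℝ}
    (hy : Tendsto y F atTop) :
    ∀ᶠ x in F, ENNReal.ofReal (y x) ≠ 0 ∧ ENNReal.ofReal (y x) ≠ ⊤ :=
  (hy.eventually_gt_atTop 0).mono fun _ hx =>
    ⟨(ENNReal.ofReal_pos.2 hx).ne', ENNReal.ofReal_ne_top⟩

theorem FirstOrderESS.unifEquiv_optESS_mixLaw
    (h : FirstOrderESS μ₀ μ₁ atTop α β (fun m => ENNReal.ofReal (y₀ m))
      fun m => ENNReal.ofReal (y₁ m))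
    (hum : ∀ᶠ m in atTop, u m ≤ m) (hy₀ : Tendsto y₀ atTop atTop) (hy₁ : Tendsto y₁ atTop atTop) :
    UnifEquiv l u (fun m s => optESS μ₀ μ₁ (mixLaw μ₀ μ₁ (s / m)) (α m) (β m))
      (fun m s => ENNReal.ofReal ((1 - (s : ℝ) / m) * y₀ m + (s : ℝ) / m * y₁ m)) := by
  have h_fst := tendsto_fst_uniformFilter l u
  have h_unif := h.comp_tendsto h_fst
  have h_split : ∀ᶠ p in uniformFilter l u,
      ENNReal.ofReal ((1 - (p.2 : ℝ) / p.1) * y₀ p.1 + (p.2 : ℝ) / p.1 * y₁ p.1) =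
        ENNReal.ofReal (1 - (p.2 : ℝ) / p.1) * ENNReal.ofReal (y₀ p.1) +
          ENNReal.ofReal ((p.2 : ℝ) / p.1) * ENNReal.ofReal (y₁ p.1) := by
    refine eventually_uniformFilter_iff.2 ?_
    filter_upwards [hum, hy₀.eventually_ge_atTop 0, hy₁.eventually_ge_atTop 0]
      with m hum h₀ h₁ s _ hs
    exact ofReal_one_sub_mul_add_mul (div_mem_Icc_of_le (hs.trans hum)) h₀ h₁
  refine unifEquiv_of_asympLE
    (x := fun p => optESS μ₀ μ₁ (mixLaw μ₀ μ₁ (p.2 / p.1)) (α p.1) (β p.1))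
    (y := fun p => ENNReal.ofReal ((1 - (p.2 : ℝ) / p.1) * y₀ p.1 + (p.2 : ℝ) / p.1 * y₁ p.1))
    ((h_unif.optESS_mixLaw_le _).trans (.of_eventually_le (h_split.mono fun p hp => hp.ge)))
    (.trans (.of_eventually_le (h_split.mono fun p hp => hp.le)) (h_unif.le_optESS_mixLaw _))
    ?_ (.of_forall fun p => ENNReal.ofReal_ne_top)
  filter_upwards [h_split, eventually_ofReal_ne_zero_and_ne_top (hy₀.comp h_fst),
    eventually_ofReal_ne_zero_and_ne_top (hy₁.comp h_fst)] with p hp h₀ h₁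
  rw [hp]
  exact ofReal_one_sub_mul_add_ofReal_mul_ne_zero h₀.1 h₁.1 _

theorem FirstOrderESS.unifEquiv_ess_mixLaw
    (h : FirstOrderESS μ₀ μ₁ atTop α β (fun m => ENNReal.ofReal (y₀ m))
      fun m => ENNReal.ofReal (y₁ m))
    (hy₀ : Tendsto y₀ atTop atTop) (hy₁ : Tendsto y₁ atTop atTop)
    (hχ : ∀ᶠ m in atTop, χ m ∈ testClass μ₀ μ₁ (α m) (β m))
    (hχ_le : AsympLE (uniformFilter l u) (fun p => (χ p.1).ess (mixLaw μ₀ μ₁ (p.2 / p.1)))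
      fun p => optESS μ₀ μ₁ (mixLaw μ₀ μ₁ (p.2 / p.1)) (α p.1) (β p.1)) :
    UnifEquiv l u (fun m s => (χ m).ess (mixLaw μ₀ μ₁ (s / m)))
      (fun m s => optESS μ₀ μ₁ (mixLaw μ₀ μ₁ (s / m)) (α m) (β m)) := by
  have h_fst := tendsto_fst_uniformFilter l u
  have h_ne := (h.comp_tendsto h_fst).eventually_optESS_mixLaw_ne
    (eventually_ofReal_ne_zero_and_ne_top (hy₀.comp h_fst))
    (eventually_ofReal_ne_zero_and_ne_top (hy₁.comp h_fst)) (fun p => p.2 / p.1)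
  exact unifEquiv_of_asympLE hχ_le
    (.of_eventually_le ((h_fst.eventually hχ).mono fun p hp => iInf₂_le _ hp)) h_ne.1 h_ne.2

theorem div_mul_sub_mul_div_le {s u m : ℕ} (hs : s ≤ u) (hu : u ≤ m) (hu₀ : 0 < u) {b : ℝ}
    (hb : 0 ≤ b) : (s : ℝ) / m * (((m : ℝ) - u) * b / u) ≤ (1 - (s : ℝ) / m) * b := by
  have hu' : (0 : ℝ) < u := by exact_mod_cast hu₀
  have hm' : (0 : ℝ) < m := by exact_mod_cast hu₀.trans_le hu
  have hsu : (s : ℝ) ≤ u := by exact_mod_cast hs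
  have hum : (u : ℝ) ≤ m := by exact_mod_cast hu
  have h_nonneg : 0 ≤ ((m : ℝ) - u) * b / m :=
    div_nonneg (mul_nonneg (sub_nonneg.2 hum) hb) hm'.le
  calc (s : ℝ) / m * (((m : ℝ) - u) * b / u) = s / u * (((m : ℝ) - u) * b / m) := by field_simp
    _ ≤ ((m : ℝ) - u) * b / m := mul_le_of_le_one_left h_nonneg ((div_le_one hu').2 hsu)
    _ ≤ ((m : ℝ) - s) * b / m := by gcongr
    _ = (1 - (s : ℝ) / m) * b := by field_simp

theorem eventually_ofReal_mul_le_of_tendsto_div_zero {f : ℕ → ℝ≥0∞} {b : ℕ → ℝ} {I ε : ℝ}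
    (hum : ∀ᶠ m in atTop, u m ≤ m) (hu : ∀ᶠ m in atTop, 0 < u m) (hb : ∀ᶠ m in atTop, 0 ≤ b m)
    (hI : 0 < I) (hε : 0 < ε)
    (hf : Tendsto (fun m => f m / ENNReal.ofReal ((m - u m) * b m / u m)) atTop (𝓝 0)) :
    ∀ᶠ p in uniformFilter l u, ENNReal.ofReal (p.2 / p.1) * f p.1 ≤
      ENNReal.ofReal ε * (ENNReal.ofReal (1 - p.2 / p.1) * ENNReal.ofReal (b p.1 / I)) := by
  refine eventually_uniformFilter_iff.2 ?_
  filter_upwards [hum, hu, hb,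
    eventually_le_ofReal_mul_of_tendsto_div hf (ENNReal.ofReal_pos.2 (div_pos hε hI))]
    with m hum hu hb hf s _ hs
  have hπ := div_mem_Icc_of_le (hs.trans hum)
  calc ENNReal.ofReal (s / m) * f m
    _ ≤ ENNReal.ofReal (s / m) *
        (ENNReal.ofReal (ε / I) * ENNReal.ofReal ((m - u m) * b m / u m)) := by gcongr
    _ = ENNReal.ofReal (ε / I) * ENNReal.ofReal (s / m * ((m - u m) * b m / u m)) := by
      rw [mul_left_comm, ENNReal.ofReal_mul hπ.1]
    _ ≤ ENNReal.ofReal (ε / I) * ENNReal.ofReal ((1 - s / m) * b m) := by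
      gcongr ENNReal.ofReal (ε / I) * ENNReal.ofReal ?_
      exact div_mul_sub_mul_div_le hs hum hu hb
    _ = ENNReal.ofReal ε * (ENNReal.ofReal (1 - s / m) * ENNReal.ofReal (b m / I)) := by
      rw [← ENNReal.ofReal_mul (by positivity), ← ENNReal.ofReal_mul (sub_nonneg.2 hπ.2),
        ← ENNReal.ofReal_mul hε.le]
      ring_nf

end UniformAsymptotics

section GeneralizedErrorControl

variable {E : Type*} [MeasurableSpace E] {μ₀ μ₁ : Measure E} [IsProbabilityMeasure μ₀]
  [IsProbabilityMeasure μ₁] {l u κ ι : ℕ → ℕ} {α β I₀ I₁ : ℝ}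

theorem FirstOrderESS.of_isEquivalent_log {X : Type*} {F : Filter X} {a b A B : X → ℝ}
    (hI₀ : 0 < I₀) (hI₁ : 0 < I₁)
    (hKL₀ : InformationTheory.klDiv μ₀ μ₁ = ENNReal.ofReal I₀)
    (hKL₁ : InformationTheory.klDiv μ₁ μ₀ = ENNReal.ofReal I₁)
    (ha : Tendsto a F (𝓝[>] 0)) (hb : Tendsto b F (𝓝[>] 0))
    (haA : Asymptotics.IsEquivalent F (fun x => Real.log (1 / a x)) A)
    (hbB : Asymptotics.IsEquivalent F (fun x => Real.log (1 / b x)) B) :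
    FirstOrderESS μ₀ μ₁ F a b (fun x => ENNReal.ofReal (B x / I₀))
      (fun x => ENNReal.ofReal (A x / I₁)) := by
  obtain ⟨Z, hZ, ⟨hZ₀, rfl⟩, hZ₁, rfl⟩ := exists_isLLR_of_klDiv_eq hI₀.le hI₁.le hKL₀ hKL₁
  have h_nonneg {f : X → ℝ} (hf : Tendsto f F atTop) {I : ℝ} (hI : 0 < I) :
      ∀ᶠ x in F, 0 ≤ f x / I := (hf.atTop_div_const hI).eventually_ge_atTop 0
  have ha_atTop := tendsto_log_one_div_atTop ha
  have hb_atTop := tendsto_log_one_div_atTop hb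
  exact (hZ.firstOrderESS hZ₀ hZ₁ hI₀ hI₁ ha hb).congr
    (.of_isEquivalent (hbB.div .refl) (h_nonneg (hbB.tendsto_atTop hb_atTop) hI₀))
    (.of_isEquivalent (hbB.symm.div .refl) (h_nonneg hb_atTop hI₀))
    (.of_isEquivalent (haA.div .refl) (h_nonneg (haA.tendsto_atTop ha_atTop) hI₁))
    (.of_isEquivalent (haA.symm.div .refl) (h_nonneg ha_atTop hI₁))

theorem eventually_natCast_sub_eq (hκ : ∀ᶠ m in atTop, 1 ≤ κ m ∧ κ m ≤ m - l m) :
    ∀ᶠ m in atTop, ((m - l m : ℕ) : ℝ) = m - l m :=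
  hκ.mono fun m hm => Nat.cast_sub (by lia)

theorem alphaG_asymptotics (hκ : ∀ᶠ m in atTop, 1 ≤ κ m ∧ κ m ≤ m - l m)
    (hκl : Tendsto (fun m => (κ m : ℝ) / (m - l m)) atTop (𝓝 0)) (hα : α ∈ Set.Ioo 0 1) :
    Tendsto (alphaG l κ α) atTop (𝓝[>] 0) ∧
      Tendsto (fun m => Real.log ((m - l m) / κ m)) atTop atTop ∧
      Asymptotics.IsEquivalent atTop (fun m => Real.log (1 / alphaG l κ α m))
        (fun m => Real.log ((m - l m) / κ m)) := by
  have h_cast := eventually_natCast_sub_eq hκ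
  have h_log : (fun m => Real.log ((m - l m : ℕ) / κ m)) =ᶠ[atTop]
      fun m => Real.log ((m - l m) / κ m) := h_cast.mono fun m hm => by simp only [hm]
  have hκl' : Tendsto (fun m => (κ m : ℝ) / (m - l m : ℕ)) atTop (𝓝 0) :=
    hκl.congr' (h_cast.mono fun m hm => by simp only [hm])
  exact ⟨tendsto_binomLevel_nhdsGT_zero hα hκ hκl',
    (tendsto_log_natCast_div_natCast_atTop hκ hκl').congr' h_log,
    (isEquivalent_log_one_div_binomLevel hα hκ hκl').congr_right h_log⟩

theorem mainTheorem9_general (hI₀ : 0 < I₀) (hI₁ : 0 < I₁)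
    (hKL₀ : InformationTheory.klDiv μ₀ μ₁ = ENNReal.ofReal I₀)
    (hKL₁ : InformationTheory.klDiv μ₁ μ₀ = ENNReal.ofReal I₁)
    (hum : ∀ᶠ m in atTop, u m ≤ m)
    (hι : ∀ᶠ m in atTop, 1 ≤ ι m ∧ ι m ≤ u m)
    (hκ : ∀ᶠ m in atTop, 1 ≤ κ m ∧ κ m ≤ m - l m)
    (hιu : Tendsto (fun m => (ι m : ℝ) / u m) atTop (𝓝 0))
    (hκl : Tendsto (fun m => (κ m : ℝ) / (m - l m)) atTop (𝓝 0))
    {χ : ℝ → ℝ → SeqTest E}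
    (hχ : ∀ α ∈ Set.Ioo (0 : ℝ) 1, ∀ β ∈ Set.Ioo (0 : ℝ) 1, χ α β ∈ testClass μ₀ μ₁ α β)
    (hα : α ∈ Set.Ioo 0 1) (hβ : β ∈ Set.Ioo 0 1) :
    UnifEquiv l u
      (fun m s => optESS μ₀ μ₁ (mixLaw μ₀ μ₁ (s / m)) (alphaG l κ α m) (betaG u ι β m))
      (fun m s => ENNReal.ofReal
        ((1 - (s : ℝ) / m) * (Real.log (u m / ι m) / I₀) +
          (s : ℝ) / m * (Real.log ((m - l m) / κ m) / I₁))) ∧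
    (Tendsto (fun m => (χ (alphaG l κ α m) (betaG u ι β m)).ess (iidLaw μ₀) /
        optESS μ₀ μ₁ (iidLaw μ₀) (alphaG l κ α m) (betaG u ι β m)) atTop (𝓝 1) →
      (Tendsto (fun m => (χ (alphaG l κ α m) (betaG u ι β m)).ess (iidLaw μ₁) /
          optESS μ₀ μ₁ (iidLaw μ₁) (alphaG l κ α m) (betaG u ι β m)) atTop (𝓝 1) ∨
        Tendsto (fun m => (χ (alphaG l κ α m) (betaG u ι β m)).ess (iidLaw μ₁) /
          ENNReal.ofReal ((m - u m) * Real.log (u m / ι m) / u m)) atTop (𝓝 0)) →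
      UnifEquiv l u
        (fun m s => (χ (alphaG l κ α m) (betaG u ι β m)).ess (mixLaw μ₀ μ₁ (s / m)))
        (fun m s => optESS μ₀ μ₁ (mixLaw μ₀ μ₁ (s / m)) (alphaG l κ α m) (betaG u ι β m))) := by
  obtain ⟨hα_zero, hA, hα_log⟩ := alphaG_asymptotics hκ hκl hα
  have hβ_zero : Tendsto (betaG u ι β) atTop (𝓝[>] 0) := tendsto_binomLevel_nhdsGT_zero hβ hι hιu
  have hB := tendsto_log_natCast_div_natCast_atTop hι hιu
  have hA' := hA.atTop_div_const hI₁
  have hB' := hB.atTop_div_const hI₀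
  have h := FirstOrderESS.of_isEquivalent_log hI₀ hI₁ hKL₀ hKL₁ hα_zero hβ_zero hα_log
    (isEquivalent_log_one_div_binomLevel hβ hι hιu)
  have hχ_mem := ((hα_zero.eventually (Ioo_mem_nhdsGT one_pos)).and
    (hβ_zero.eventually (Ioo_mem_nhdsGT one_pos))).mono fun m hm => hχ _ hm.1 _ hm.2
  have h_fst := tendsto_fst_uniformFilter l u
  refine ⟨h.unifEquiv_optESS_mixLaw hum hB' hA', fun hχ₀ hχ₁ =>
    h.unifEquiv_ess_mixLaw hB' hA' hχ_mem ?_⟩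
  have hχ₀' := (AsympLE.of_tendsto_div hχ₀).comp_tendsto h_fst
  rcases hχ₁ with hχ₁ | hχ₁
  · exact asympLE_ess_mixLaw_of_asympLE_optESS hχ₀'
      ((AsympLE.of_tendsto_div hχ₁).comp_tendsto h_fst) _
  · refine (h.comp_tendsto h_fst).ess_mixLaw_le_of_negligible
      (π := fun p => (p.2 : ℝ) / p.1) hχ₀' fun ε hε => ?_
    exact eventually_ofReal_mul_le_of_tendsto_div_zero
      (f := fun m => (χ (alphaG l κ α m) (betaG u ι β m)).ess (iidLaw μ₁))
      (b := fun m => Real.log (u m / ι m)) hum (hι.mono fun m hm => hm.1.trans hm.2)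
      (hB.eventually_ge_atTop 0) hI₀ hε hχ₁

end GeneralizedErrorControl

theorem mainTheorem9 {E : Type*} [MeasurableSpace E] (ν : Measure E) [SigmaFinite ν]
    (f₀ f₁ : E → ℝ≥0∞) (hf₀ : Measurable f₀) (hf₁ : Measurable f₁)
    [IsProbabilityMeasure (ν.withDensity f₀)] [IsProbabilityMeasure (ν.withDensity f₁)]
    (I₀ I₁ : ℝ) (hI₀ : 0 < I₀) (hI₁ : 0 < I₁)
    (hKL₀ : InformationTheory.klDiv (ν.withDensity f₀) (ν.withDensity f₁) = ENNReal.ofReal I₀)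
    (hKL₁ : InformationTheory.klDiv (ν.withDensity f₁) (ν.withDensity f₀) = ENNReal.ofReal I₁)
    (l u κ ι : ℕ → ℕ)
    (hlu : ∀ᶠ m in atTop, l m ≤ u m ∧ u m ≤ m)
    (hι : ∀ᶠ m in atTop, 1 ≤ ι m ∧ ι m < u m)
    (hκ : ∀ᶠ m in atTop, 1 ≤ κ m ∧ κ m < m - l m)
    (hu : Tendsto u atTop atTop)
    (hl : Tendsto (fun m => m - l m) atTop atTop)
    (hιu : Tendsto (fun m => (ι m : ℝ) / (u m : ℝ)) atTop (𝓝 0))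
    (hκl : Tendsto (fun m => (κ m : ℝ) / ((m : ℝ) - (l m : ℝ))) atTop (𝓝 0))
    (χ : ℝ → ℝ → SeqTest E)
    (hχ : ∀ α ∈ Set.Ioo (0 : ℝ) 1, ∀ β ∈ Set.Ioo (0 : ℝ) 1,
      χ α β ∈ testClass (ν.withDensity f₀) (ν.withDensity f₁) α β) :
    (∀ α ∈ Set.Ioo (0 : ℝ) (1 / 2), ∀ β ∈ Set.Ioo (0 : ℝ) (1 / 2),
      UnifEquiv l u
        (fun m s => optESS (ν.withDensity f₀) (ν.withDensity f₁)
          (mixLaw (ν.withDensity f₀) (ν.withDensity f₁) ((s : ℝ) / m))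
          (alphaG l κ α m) (betaG u ι β m))
        (fun m s => ENNReal.ofReal
          ((1 - (s : ℝ) / m) * (Real.log ((u m : ℝ) / ι m) / I₀) +
            (s : ℝ) / m * (Real.log (((m : ℝ) - l m) / κ m) / I₁)))) ∧
    ((∀ α ∈ Set.Ioo (0 : ℝ) (1 / 2), ∀ β ∈ Set.Ioo (0 : ℝ) (1 / 2),
        Tendsto (fun m => (χ (alphaG l κ α m) (betaG u ι β m)).ess (iidLaw (ν.withDensity f₀)) /
          optESS (ν.withDensity f₀) (ν.withDensity f₁) (iidLaw (ν.withDensity f₀))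
            (alphaG l κ α m) (betaG u ι β m)) atTop (𝓝 1) ∧
        Tendsto (fun m => (χ (alphaG l κ α m) (betaG u ι β m)).ess (iidLaw (ν.withDensity f₁)) /
          optESS (ν.withDensity f₀) (ν.withDensity f₁) (iidLaw (ν.withDensity f₁))
            (alphaG l κ α m) (betaG u ι β m)) atTop (𝓝 1)) →
      HighDimOptimal (ν.withDensity f₀) (ν.withDensity f₁) l u κ ι χ) ∧
    ((∀ α ∈ Set.Ioo (0 : ℝ) (1 / 2), ∀ β ∈ Set.Ioo (0 : ℝ) (1 / 2),
        Tendsto (fun m => (χ (alphaG l κ α m) (betaG u ι β m)).ess (iidLaw (ν.withDensity f₀)) /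
          optESS (ν.withDensity f₀) (ν.withDensity f₁) (iidLaw (ν.withDensity f₀))
            (alphaG l κ α m) (betaG u ι β m)) atTop (𝓝 1) ∧
        Tendsto (fun m => (χ (alphaG l κ α m) (betaG u ι β m)).ess (iidLaw (ν.withDensity f₁)) /
          ENNReal.ofReal (((m : ℝ) - u m) * Real.log ((u m : ℝ) / ι m) / u m)) atTop (𝓝 0)) →
      HighDimOptimal (ν.withDensity f₀) (ν.withDensity f₁) l u κ ι χ) := by
  have h {α β : ℝ} (hα : α ∈ Set.Ioo 0 (1 / 2)) (hβ : β ∈ Set.Ioo 0 (1 / 2)) :=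
    mainTheorem9_general hI₀ hI₁ hKL₀ hKL₁ (hlu.mono fun m hm => hm.2)
      (hι.mono fun m hm => ⟨hm.1, hm.2.le⟩) (hκ.mono fun m hm => ⟨hm.1, hm.2.le⟩) hιu hκl hχ
      (Set.Ioo_subset_Ioo_right one_half_lt_one.le hα)
      (Set.Ioo_subset_Ioo_right one_half_lt_one.le hβ)
  exact ⟨fun α hα β hβ => (h hα hβ).1,
    fun h_opt α hα β hβ => (h hα hβ).2 (h_opt α hα β hβ).1 (.inl (h_opt α hα β hβ).2),
    fun h_opt α hα β hβ => (h hα hβ).2 (h_opt α hα β hβ).1 (.inr (h_opt α hα β hβ).2)⟩
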